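/- Let $$L=\Big\{\limsup_{|p|,|q|\to\infty,\ p,q\in\mathbb Z}\frac1{|q(q\alpha-p)|}<\infty:\ \alpha\in\mathbb R\setminus\mathbb Q\Big\}$$ be the Lagrange spectrum, and let $$M=\Big\{\frac1{\inf_{(x,y)\in\mathbb Z^2\setminus\{(0,0)\}}|ax^2+bxy+cy^2|}<\infty:\ a,b,c\in\mathbb R,\ b^2-4ac=1\Big\}$$ be the Markov spectrum. Let $$K(\{1,2,3\})=\{[0;\gamma_1,\gamma_2,\dots]:\ \gamma_n\in\{1,2,3\}\text{ for all } n\geq 1\},$$ where $[0;\gamma_1,\gamma_2,\dots]=\cfrac{1}{\gamma_1+\cfrac{1}{\gamma_2+\cdots}}$. Then there is a set $K\subset\mathbb R$ of Hausdorff dimension $HD(K)<0.281266$ such that $$(M\setminus L)\cap(3.84,\sqrt{20})\subset K(\{1,2,3\})+K,$$ where $X+Y=\{x+y:\ x\in X,\ y\in Y\}$. -/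

import Mathlib

open Filter Topology

/-- The Lagrange spectrum: the finite values of
`limsup 1 / |q (q α - p)|` as the integers `p, q` tend to infinity in absolute value,
for `α` irrational. The upper limit is taken in the extended reals, so equality with a real
number contains its finiteness. -/
def lagrangeSpectrum : Set ℝ :=
  {l | ∃ α : ℝ, Irrational α ∧
    limsup (fun z : ℤ × ℤ => ((1 / |(z.2 : ℝ) * ((z.2 : ℝ) * α - (z.1 : ℝ))| : ℝ) : EReal))
      ((cofinite : Filter ℤ) ×ˢ (cofinite : Filter ℤ)) = (l : EReal)}

/-- The infimum of `|a x² + b x y + c y²|` over the nonzero integer vectors `(x, y)`. -/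
noncomputable def formInf (a b c : ℝ) : ℝ :=
  ⨅ v : {v : ℤ × ℤ // v ≠ (0, 0)},
    |a * (v.1.1 : ℝ) ^ 2 + b * (v.1.1 : ℝ) * (v.1.2 : ℝ) + c * (v.1.2 : ℝ) ^ 2|

/-- The Markov spectrum: the finite values of `1 / inf |a x² + b x y + c y²|` over the real
indefinite binary quadratic forms of discriminant `b² - 4 a c = 1`
(a positive discriminant says that the form is indefinite). -/
def markovSpectrum : Set ℝ :=
  {m | ∃ a b c : ℝ, b ^ 2 - 4 * a * c = 1 ∧ 0 < formInf a b c ∧ m = 1 / formInf a b c}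

/-- The infinite continued fraction `[0; γ 0, γ 1, γ 2, …]`. -/
def contFrac (γ : ℕ → ℕ) : GenContFract ℝ where
  h := 0
  s := Stream'.Seq.ofStream (fun n => ⟨1, (γ n : ℝ)⟩)

/-- For a set `A` of positive integers, the set of the values of the infinite continued fractions
`[0; γ 0, γ 1, …]` all of whose partial quotients lie in `A`; the value is the limit of the
truncations `[0; γ 0, …, γ (n - 1)]`. -/
def contFracSet (A : Set ℕ) : Set ℝ :=
  {x | ∃ γ : ℕ → ℕ, (∀ n, γ n ∈ A) ∧ Tendsto (contFrac γ).convs' atTop (𝓝 x)}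

/-- The truncations `[0; γ 0, …, γ (n - 1)]`. -/
noncomputable def cfTrunc : ℕ → (ℕ → ℕ) → ℝ
  | 0, _ => 0
  | n + 1, γ => 1 / ((γ 0 : ℝ) + cfTrunc n (fun k => γ (k + 1)))

/-- All terms of the sequence lie in `{1, 2, 3}`. -/
def Digits {ι : Type*} (γ : ι → ℕ) : Prop := ∀ n, 1 ≤ γ n ∧ γ n ≤ 3

theorem Digits.comp {ι κ : Type*} {γ : ι → ℕ} (h : Digits γ) (f : κ → ι) :
    Digits (fun k => γ (f k)) := fun n => h (f n)

theorem Digits.one_le {ι : Type*} {γ : ι → ℕ} (h : Digits γ) (n : ι) : (1 : ℝ) ≤ γ n := by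
  exact_mod_cast (h n).1

theorem Digits.le_three {ι : Type*} {γ : ι → ℕ} (h : Digits γ) (n : ι) : (γ n : ℝ) ≤ 3 := by
  exact_mod_cast (h n).2

theorem Digits.cases {ι : Type*} {γ : ι → ℕ} (h : Digits γ) (n : ι) :
    γ n = 1 ∨ γ n = 2 ∨ γ n = 3 := by
  have := h n
  omega

theorem contFrac_convs' (γ : ℕ → ℕ) (n : ℕ) : (contFrac γ).convs' n = cfTrunc n γ := by
  have key : ∀ (n : ℕ) (γ : ℕ → ℕ), GenContFract.convs'Aux
      (Stream'.Seq.ofStream (fun n => (⟨1, (γ n : ℝ)⟩ : GenContFract.Pair ℝ))) n = cfTrunc n γ := by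
    intro n
    induction n with
    | zero => intro γ; rfl
    | succ n ih =>
      intro γ
      rw [GenContFract.convs'Aux_succ_some (p := ⟨1, (γ 0 : ℝ)⟩) rfl]
      have : (Stream'.Seq.ofStream (fun n => (⟨1, (γ n : ℝ)⟩ : GenContFract.Pair ℝ))).tail
          = Stream'.Seq.ofStream (fun n => (⟨1, (γ (n + 1) : ℝ)⟩ : GenContFract.Pair ℝ)) := rfl
      rw [this, ih (fun k => γ (k + 1))]
      rfl
  simp [GenContFract.convs', contFrac, key]

theorem inv_add_sub_le {g x y : ℝ} (hg : 1 ≤ g) (hx : 1 / 4 ≤ x) (hy : 1 / 4 ≤ y) :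
    |1 / (g + x) - 1 / (g + y)| ≤ 16 / 25 * |x - y| := by
  have h1 : 0 < g + x := by linarith
  have h2 : 0 < g + y := by linarith
  have : 1 / (g + x) - 1 / (g + y) = (y - x) / ((g + x) * (g + y)) := by
    field_simp; ring
  rw [this, abs_div, abs_of_pos (mul_pos h1 h2), abs_sub_comm, div_le_iff₀ (mul_pos h1 h2)]
  have h3 : (25 / 16 : ℝ) ≤ (g + x) * (g + y) := by nlinarith
  nlinarith [abs_nonneg (x - y)]

theorem inv_add_mem {g x : ℝ} (hg : 1 ≤ g) (hg3 : g ≤ 3) (hx : 1 / 4 ≤ x) (hx1 : x ≤ 1) :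
    1 / 4 ≤ 1 / (g + x) ∧ 1 / (g + x) ≤ 4 / 5 := by
  constructor
  · rw [div_le_div_iff₀ (by norm_num) (by linarith)]; linarith
  · rw [div_le_div_iff₀ (by linarith) (by norm_num)]; linarith

/-- Two solutions of the continued fraction recursion with the same first `n` partial quotients
are exponentially close. -/
theorem cf_recursion_dist {g X Y : ℕ → ℝ} (hg : ∀ i, 1 ≤ g i) :
    ∀ (n i : ℕ), (∀ j, i ≤ j → j < i + n → X j = 1 / (g j + X (j + 1))) →
    (∀ j, i ≤ j → j < i + n → Y j = 1 / (g j + Y (j + 1))) →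
    (∀ i, 1 / 4 ≤ X i ∧ X i ≤ 1) → (∀ i, 1 / 4 ≤ Y i ∧ Y i ≤ 1) →
    |X i - Y i| ≤ (16 / 25) ^ n := by
  intro n
  induction n with
  | zero =>
    intro i _ _ hX hY
    rw [pow_zero, abs_le]
    constructor <;> linarith [hX i, hY i]
  | succ n ih =>
    intro i h1 h2 hX hY
    rw [h1 i le_rfl (by omega), h2 i le_rfl (by omega)]
    refine (inv_add_sub_le (hg i) (hX _).1 (hY _).1).trans ?_
    rw [pow_succ']
    gcongr
    exact ih (i + 1) (fun j hj hj' => h1 j (by omega) (by omega))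
      (fun j hj hj' => h2 j (by omega) (by omega)) hX hY

theorem cfTrunc_mem {γ : ℕ → ℕ} (h : Digits γ) (n : ℕ) :
    1 / 4 ≤ cfTrunc (n + 1) γ ∧ cfTrunc (n + 1) γ ≤ 1 := by
  induction n generalizing γ with
  | zero =>
    have h1 := h.one_le 0
    have h3 := h.le_three 0
    simp only [cfTrunc, add_zero]
    constructor
    · rw [div_le_div_iff₀ (by norm_num) (by linarith)]; linarith
    · rw [div_le_one (by linarith)]; exact h1
  | succ n ih =>
    have h1 := ih (h.comp (fun k => k + 1))
    have := inv_add_mem (h.one_le 0) (h.le_three 0) h1.1 h1.2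
    rw [cfTrunc]
    exact ⟨this.1, this.2.trans (by norm_num)⟩

theorem cfTrunc_succ_sub {γ : ℕ → ℕ} (h : Digits γ) (n : ℕ) :
    |cfTrunc (n + 1) γ - cfTrunc (n + 2) γ| ≤ (16 / 25) ^ n := by
  induction n generalizing γ with
  | zero =>
    rw [pow_zero, abs_le]
    constructor <;> linarith [cfTrunc_mem h 0, cfTrunc_mem h 1]
  | succ n ih =>
    have h' := h.comp (fun k : ℕ => k + 1)
    rw [cfTrunc, cfTrunc]
    refine (inv_add_sub_le (h.one_le 0) (cfTrunc_mem h' n).1 (cfTrunc_mem h' (n + 1)).1).trans ?_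
    rw [pow_succ']
    gcongr
    exact ih h'

/-- The value of the infinite continued fraction `[0; γ 0, γ 1, …]`. -/
noncomputable def cfVal (γ : ℕ → ℕ) : ℝ := limUnder atTop (fun n => cfTrunc n γ)

theorem tendsto_cfTrunc {γ : ℕ → ℕ} (h : Digits γ) :
    Tendsto (fun n => cfTrunc n γ) atTop (𝓝 (cfVal γ)) := by
  have hc : CauchySeq (fun n => cfTrunc (n + 1) γ) :=
    cauchySeq_of_le_geometric (16 / 25) 1 (by norm_num) (fun n => by
      rw [Real.dist_eq, one_mul]; exact cfTrunc_succ_sub h n)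
  obtain ⟨x, hx⟩ := cauchySeq_tendsto_of_complete hc
  exact tendsto_nhds_limUnder ⟨x, (tendsto_add_atTop_iff_nat 1).1 hx⟩

theorem cfVal_mem_contFracSet {γ : ℕ → ℕ} (h : Digits γ) :
    cfVal γ ∈ contFracSet {1, 2, 3} := by
  refine ⟨γ, fun n => by simpa using h.cases n, ?_⟩
  have : (contFrac γ).convs' = fun n => cfTrunc n γ := funext (contFrac_convs' γ)
  rw [this]
  exact tendsto_cfTrunc h

theorem cfVal_mem_one {γ : ℕ → ℕ} (h : Digits γ) : 1 / 4 ≤ cfVal γ ∧ cfVal γ ≤ 1 := by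
  have ht := (tendsto_add_atTop_iff_nat 1).2 (tendsto_cfTrunc h)
  exact ⟨ge_of_tendsto' ht (fun n => (cfTrunc_mem h n).1),
    le_of_tendsto' ht (fun n => (cfTrunc_mem h n).2)⟩

theorem cfVal_eq {γ : ℕ → ℕ} (h : Digits γ) :
    cfVal γ = 1 / ((γ 0 : ℝ) + cfVal (fun k => γ (k + 1))) := by
  have h' := h.comp (fun k : ℕ => k + 1)
  have h1 := (tendsto_add_atTop_iff_nat 1).2 (tendsto_cfTrunc h)
  have h2 : Tendsto (fun n => cfTrunc (n + 1) γ) atTop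
      (𝓝 (1 / ((γ 0 : ℝ) + cfVal (fun k => γ (k + 1))))) := by
    simp only [cfTrunc]
    refine Tendsto.div tendsto_const_nhds (tendsto_const_nhds.add (tendsto_cfTrunc h')) ?_
    have := h.one_le 0
    have := (cfVal_mem_one h').1
    positivity
  exact tendsto_nhds_unique h1 h2

theorem cfVal_mem {γ : ℕ → ℕ} (h : Digits γ) : 1 / 4 ≤ cfVal γ ∧ cfVal γ ≤ 4 / 5 := by
  have h' := cfVal_mem_one (h.comp (fun k : ℕ => k + 1))
  rw [cfVal_eq h]
  exact inv_add_mem (h.one_le 0) (h.le_three 0) h'.1 h'.2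

theorem cfVal_pos {γ : ℕ → ℕ} (h : Digits γ) : 0 < cfVal γ := by
  linarith [(cfVal_mem h).1]

theorem cfVal_shift {γ : ℕ → ℕ} (h : Digits γ) (i : ℕ) :
    cfVal (fun k => γ (k + i)) = 1 / ((γ i : ℝ) + cfVal (fun k => γ (k + (i + 1)))) := by
  rw [cfVal_eq (h.comp (fun k => k + i))]
  simp only [zero_add]
  congr 3
  funext k
  congr 1
  omega

/-- A bounded solution of the continued fraction recursion is the value of the continued
fraction. -/
theorem cfVal_unique {γ : ℕ → ℕ} (h : Digits γ) {X : ℕ → ℝ} (hX : ∀ i, 1 / 4 ≤ X i ∧ X i ≤ 1)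
    (hrec : ∀ i, X i = 1 / ((γ i : ℝ) + X (i + 1))) : X 0 = cfVal γ := by
  have key : ∀ n : ℕ, |X 0 - cfVal (fun k => γ (k + 0))| ≤ (16 / 25 : ℝ) ^ n := fun n =>
    cf_recursion_dist (g := fun i => (γ i : ℝ)) (Y := fun i => cfVal (fun k => γ (k + i)))
      h.one_le n 0 (fun j _ _ => hrec j) (fun j _ _ => cfVal_shift h j) hX
      (fun i => cfVal_mem_one (h.comp (fun k => k + i)))
  have h0 : |X 0 - cfVal γ| ≤ 0 :=
    ge_of_tendsto' (tendsto_pow_atTop_nhds_zero_of_lt_one (by norm_num) (by norm_num)) key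
  exact sub_eq_zero.1 (abs_nonpos_iff.1 h0)

theorem cfVal_dist {γ δ : ℕ → ℕ} (hγ : Digits γ) (hδ : Digits δ) {n : ℕ}
    (h : ∀ i < n, γ i = δ i) : |cfVal γ - cfVal δ| ≤ (16 / 25) ^ n :=
  cf_recursion_dist (g := fun i => (γ i : ℝ)) (X := fun i => cfVal (fun k => γ (k + i)))
    (Y := fun i => cfVal (fun k => δ (k + i))) hγ.one_le n 0 (fun j _ _ => cfVal_shift hγ j)
    (fun j _ hj => by rw [h j (by omega)]; exact cfVal_shift hδ j)
    (fun i => cfVal_mem_one (hγ.comp (fun k => k + i)))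
    (fun i => cfVal_mem_one (hδ.comp (fun k => k + i)))

theorem inv_add_mem_uIcc {g x y z : ℝ} (hg : 0 < g) (hx : 0 ≤ x) (hy : 0 ≤ y)
    (h : z ∈ Set.uIcc x y) : 1 / (g + z) ∈ Set.uIcc (1 / (g + x)) (1 / (g + y)) := by
  rw [Set.mem_uIcc] at h ⊢
  rcases h with ⟨h1, h2⟩ | ⟨h1, h2⟩
  · right
    constructor <;> apply one_div_le_one_div_of_le <;> linarith
  · left
    constructor <;> apply one_div_le_one_div_of_le <;> linarith

/-- Prepending the same partial quotients preserves betweenness. -/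
theorem cfVal_mem_uIcc {γ δ θ : ℕ → ℕ} (hγ : Digits γ) (hδ : Digits δ) (hθ : Digits θ) (n : ℕ)
    (h1 : ∀ i < n, γ i = θ i) (h2 : ∀ i < n, δ i = θ i)
    (h : cfVal (fun k => θ (k + n)) ∈
      Set.uIcc (cfVal (fun k => γ (k + n))) (cfVal (fun k => δ (k + n)))) :
    cfVal θ ∈ Set.uIcc (cfVal γ) (cfVal δ) := by
  induction n generalizing γ δ θ with
  | zero => exact h
  | succ n ih =>
    rw [cfVal_eq hγ, cfVal_eq hδ, cfVal_eq hθ, h1 0 (by omega), h2 0 (by omega)]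
    have hγ' := hγ.comp (fun k : ℕ => k + 1)
    have hδ' := hδ.comp (fun k : ℕ => k + 1)
    refine inv_add_mem_uIcc (by linarith [hθ.one_le 0]) (cfVal_pos hγ').le (cfVal_pos hδ').le ?_
    exact ih hγ' hδ' (hθ.comp (fun k : ℕ => k + 1)) (fun i hi => h1 (i + 1) (by omega))
      (fun i hi => h2 (i + 1) (by omega)) h

theorem cfVal_lt_of_digit_lt {γ δ : ℕ → ℕ} (hγ : Digits γ) (hδ : Digits δ) (h : γ 0 < δ 0) :
    cfVal δ < cfVal γ := by
  have hγ' := cfVal_mem (hγ.comp (fun k : ℕ => k + 1))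
  have hδ' := cfVal_mem (hδ.comp (fun k : ℕ => k + 1))
  have : (γ 0 : ℝ) + 1 ≤ δ 0 := by exact_mod_cast h
  rw [cfVal_eq hγ, cfVal_eq hδ]
  have := hγ.one_le 0
  apply one_div_lt_one_div_of_lt <;> linarith

theorem cfVal_lt_of_second_digit_lt {γ δ : ℕ → ℕ} (hγ : Digits γ) (hδ : Digits δ)
    (h0 : γ 0 = δ 0) (h : δ 1 < γ 1) : cfVal δ < cfVal γ := by
  have := cfVal_lt_of_digit_lt (hδ.comp (fun k : ℕ => k + 1)) (hγ.comp (fun k : ℕ => k + 1)) h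
  rw [cfVal_eq hγ, cfVal_eq hδ, h0]
  have h2 := cfVal_pos (hγ.comp (fun k : ℕ => k + 1))
  have := hδ.one_le 0
  apply one_div_lt_one_div_of_lt <;> linarith

/-- The denominators `q n` of the truncations `[0; γ 0, …, γ (n - 1)]`, paired with the
preceding denominator. -/
def cfDen (γ : ℕ → ℕ) : ℕ → ℕ × ℕ
  | 0 => (1, 0)
  | n + 1 => (γ n * (cfDen γ n).1 + (cfDen γ n).2, (cfDen γ n).1)

/-- The numerators of the truncations `[0; γ 0, …, γ (n - 1)]`, paired with the
preceding numerator. -/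
def cfNum (γ : ℕ → ℕ) : ℕ → ℕ × ℕ
  | 0 => (0, 1)
  | n + 1 => (γ n * (cfNum γ n).1 + (cfNum γ n).2, (cfNum γ n).1)

theorem cfDen_congr {γ δ : ℕ → ℕ} {n : ℕ} (h : ∀ i < n, γ i = δ i) : cfDen γ n = cfDen δ n := by
  induction n with
  | zero => rfl
  | succ n ih => rw [cfDen, cfDen, ih (fun i hi => h i (by omega)), h n (by omega)]

theorem cfNum_congr {γ δ : ℕ → ℕ} {n : ℕ} (h : ∀ i < n, γ i = δ i) : cfNum γ n = cfNum δ n := by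
  induction n with
  | zero => rfl
  | succ n ih => rw [cfNum, cfNum, ih (fun i hi => h i (by omega)), h n (by omega)]

theorem cfDen_pos {γ : ℕ → ℕ} (h : Digits γ) (n : ℕ) : 0 < (cfDen γ n).1 := by
  induction n with
  | zero => simp [cfDen]
  | succ n ih =>
    rw [cfDen]
    have := Nat.mul_pos (h n).1 ih
    simp only
    omega

theorem cfDen_snd_le {γ : ℕ → ℕ} (h : Digits γ) (n : ℕ) : (cfDen γ n).2 ≤ (cfDen γ n).1 := by
  cases n with
  | zero => simp [cfDen]
  | succ n =>
    simp only [cfDen]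
    have := Nat.mul_le_mul_right (cfDen γ n).1 (h n).1
    omega

theorem cfDen_fst_le {γ : ℕ → ℕ} (h : Digits γ) (n : ℕ) :
    (cfDen γ (n + 1)).1 ≤ 4 * (cfDen γ (n + 1)).2 := by
  simp only [cfDen]
  have := Nat.mul_le_mul_right (cfDen γ n).1 (h n).2
  have := cfDen_snd_le h n
  omega

theorem cfDen_snd_le_four_fifths {γ : ℕ → ℕ} (h : Digits γ) (n : ℕ) :
    5 * (cfDen γ (n + 2)).2 ≤ 4 * (cfDen γ (n + 2)).1 := by
  have h1 := cfDen_fst_le h n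
  rw [cfDen]
  simp only
  have := Nat.mul_le_mul_right (cfDen γ (n + 1)).1 (h (n + 1)).1
  omega

theorem cf_det (γ : ℕ → ℕ) (n : ℕ) :
    ((cfNum γ n).1 : ℤ) * (cfDen γ n).2 - (cfNum γ n).2 * (cfDen γ n).1 = (-1) ^ (n + 1) := by
  induction n with
  | zero => simp [cfNum, cfDen]
  | succ n ih =>
    rw [cfNum, cfDen, pow_succ, ← ih]
    push_cast
    ring

theorem cfVal_eq_mobius {γ : ℕ → ℕ} (h : Digits γ) (n : ℕ) :
    cfVal γ * ((cfDen γ n).1 + (cfDen γ n).2 * cfVal (fun k => γ (k + n))) =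
      (cfNum γ n).1 + (cfNum γ n).2 * cfVal (fun k => γ (k + n)) := by
  induction n with
  | zero => simp [cfNum, cfDen]
  | succ n ih =>
    have hx := cfVal_shift h n
    have hp := cfVal_pos (h.comp (fun k => k + (n + 1)))
    have h1 := h.one_le n
    set x := cfVal (fun k => γ (k + n))
    set y := cfVal (fun k => γ (k + (n + 1)))
    have hxy : x * (γ n + y) = 1 := by
      rw [hx]; field_simp
    simp only [cfNum, cfDen]
    push_cast
    linear_combination (γ n + y) * ih + ((cfNum γ n).2 - cfVal γ * (cfDen γ n).2) * hxy

/-- The length `1 / (q (q + q'))` of the interval of continued fractions beginning with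
`γ 0, …, γ (n - 1)`. -/
noncomputable def cylLength (γ : ℕ → ℕ) (n : ℕ) : ℝ :=
  1 / ((cfDen γ n).1 * ((cfDen γ n).1 + (cfDen γ n).2))

theorem cylLength_pos {γ : ℕ → ℕ} (h : Digits γ) (n : ℕ) : 0 < cylLength γ n := by
  have : (0 : ℝ) < (cfDen γ n).1 := by exact_mod_cast cfDen_pos h n
  unfold cylLength
  positivity

theorem cylLength_congr {γ δ : ℕ → ℕ} {n : ℕ} (h : ∀ i < n, γ i = δ i) :
    cylLength γ n = cylLength δ n := by
  rw [cylLength, cylLength, cfDen_congr h]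

theorem cfVal_dist_le_cylLength {γ δ : ℕ → ℕ} (hγ : Digits γ) (hδ : Digits δ) {n : ℕ}
    (h : ∀ i < n, γ i = δ i) : |cfVal γ - cfVal δ| ≤ cylLength γ n := by
  have h1 := cfVal_eq_mobius hγ n
  have h2 := cfVal_eq_mobius hδ n
  rw [← cfDen_congr h, ← cfNum_congr h] at h2
  have hx := cfVal_mem (hγ.comp (fun k => k + n))
  have hy := cfVal_mem (hδ.comp (fun k => k + n))
  have hq : (0 : ℝ) < (cfDen γ n).1 := by exact_mod_cast cfDen_pos hγ n
  have hq' : (0 : ℝ) ≤ (cfDen γ n).2 := by positivity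
  have hdet : ((cfNum γ n).1 : ℝ) * (cfDen γ n).2 - (cfNum γ n).2 * (cfDen γ n).1
      = (-1) ^ (n + 1) := by exact_mod_cast cf_det γ n
  rw [cylLength]
  set x := cfVal (fun k => γ (k + n))
  set y := cfVal (fun k => δ (k + n))
  set q := ((cfDen γ n).1 : ℝ)
  set q' := ((cfDen γ n).2 : ℝ)
  have hx0 : 0 < q + q' * x := by nlinarith
  have hy0 : 0 < q + q' * y := by nlinarith
  have e : (cfVal γ - cfVal δ) * ((q + q' * x) * (q + q' * y)) = (-1) ^ (n + 1) * (y - x) := by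
    rw [← hdet]
    linear_combination (q + q' * y) * h1 - (q + q' * x) * h2
  have e' : |cfVal γ - cfVal δ| * ((q + q' * x) * (q + q' * y)) = |y - x| := by
    have := congrArg abs e
    rwa [abs_mul, abs_of_pos (mul_pos hx0 hy0), abs_mul, abs_pow, abs_neg, abs_one, one_pow,
      one_mul] at this
  rw [le_div_iff₀ (by positivity)]
  have h3 : |y - x| * (q * (q + q')) ≤ (q + q' * x) * (q + q' * y) := by
    rcases abs_cases (y - x) with ⟨h, -⟩ | ⟨h, -⟩ <;> rw [h] <;>
      nlinarith [mul_nonneg hq.le hq', mul_nonneg hq' hq', mul_nonneg (mul_nonneg hq' hq')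
        (mul_nonneg (show 0 ≤ x by linarith) (show 0 ≤ y by linarith)), mul_pos hq hq]
  have h4 : 0 ≤ |cfVal γ - cfVal δ| := abs_nonneg _
  have h5 : 0 < (q + q' * x) * (q + q' * y) := by positivity
  have h6 : |cfVal γ - cfVal δ| * (q * (q + q')) * ((q + q' * x) * (q + q' * y))
      ≤ 1 * ((q + q' * x) * (q + q' * y)) := by
    calc _ = |y - x| * (q * (q + q')) := by rw [← e']; ring
      _ ≤ _ := by rw [one_mul]; exact h3
  exact le_of_mul_le_mul_right h6 h5

/-- The weight of a cylinder: its length raised to the power `9 / 32`. -/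
noncomputable def cylWeight (γ : ℕ → ℕ) (n : ℕ) : ℝ := cylLength γ n ^ (9 / 32 : ℝ)

theorem rpow_le_of_pow_le {x a : ℝ} (hx : 0 ≤ x) (ha : 0 ≤ a) (h : x ^ 9 ≤ a ^ 32) :
    x ^ (9 / 32 : ℝ) ≤ a := by
  have h1 : (x ^ (9 / 32 : ℝ)) ^ 32 = x ^ 9 := by
    rw [← Real.rpow_natCast, ← Real.rpow_mul hx, ← Real.rpow_natCast]
    norm_num
  rw [← h1] at h
  exact le_of_pow_le_pow_left₀ (by norm_num) ha h

theorem cylWeight_le {γ δ : ℕ → ℕ} (hγ : Digits γ) (hδ : Digits δ) {m n : ℕ} {ρ a : ℝ}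
    (hρ : 0 ≤ ρ) (ha : 0 ≤ a) (hρa : ρ ^ 9 ≤ a ^ 32) (h : cylLength δ m ≤ ρ * cylLength γ n) :
    cylWeight δ m ≤ a * cylWeight γ n := by
  have h0 := (cylLength_pos hγ n).le
  calc cylLength δ m ^ (9 / 32 : ℝ) ≤ (ρ * cylLength γ n) ^ (9 / 32 : ℝ) :=
        Real.rpow_le_rpow (cylLength_pos hδ m).le h (by norm_num)
    _ = ρ ^ (9 / 32 : ℝ) * cylLength γ n ^ (9 / 32 : ℝ) := Real.mul_rpow hρ h0
    _ ≤ a * cylLength γ n ^ (9 / 32 : ℝ) :=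
        mul_le_mul_of_nonneg_right (rpow_le_of_pow_le hρ ha hρa) (Real.rpow_nonneg h0 _)

theorem cylLength_ratio {q q' Q Q' ρ : ℝ} (hq : 0 < q) (hq' : 0 ≤ q') (hQ : 0 < Q) (hQ' : 0 ≤ Q')
    (h : q * (q + q') ≤ ρ * (Q * (Q + Q'))) :
    1 / (Q * (Q + Q')) ≤ ρ * (1 / (q * (q + q'))) := by
  rw [mul_one_div, div_le_div_iff₀ (by positivity) (by positivity), one_mul]
  exact h

theorem cylLength_succ_le {γ : ℕ → ℕ} (h : Digits γ) (n : ℕ) :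
    cylLength γ (n + 1) ≤ 1 * cylLength γ n := by
  have h1 := h.one_le n
  have hq : (0 : ℝ) < (cfDen γ n).1 := by exact_mod_cast cfDen_pos h n
  have hq' : (0 : ℝ) ≤ (cfDen γ n).2 := by positivity
  simp only [cylLength, cfDen]
  push_cast
  refine cylLength_ratio hq hq' (by positivity) hq.le ?_
  nlinarith [mul_nonneg hq.le hq', mul_pos hq hq, mul_nonneg (sub_nonneg.2 h1) hq.le]

theorem cylWeight_succ_le {γ : ℕ → ℕ} (h : Digits γ) (n : ℕ) :
    cylWeight γ (n + 1) ≤ cylWeight γ n := by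
  have := cylWeight_le h h (by norm_num) (by norm_num) (by norm_num : (1 : ℝ) ^ 9 ≤ 1 ^ 32)
    (cylLength_succ_le h n)
  rwa [one_mul] at this

theorem cylWeight_three {γ δ : ℕ → ℕ} (hγ : Digits γ) (hδ : Digits δ) {n : ℕ} (hn : 2 ≤ n)
    (h : ∀ i < n, δ i = γ i) (h0 : δ n = 3) :
    cylWeight δ (n + 1) ≤ 0.5225 * cylWeight γ n := by
  have hq : (0 : ℝ) < (cfDen γ n).1 := by exact_mod_cast cfDen_pos hγ n
  have hq' : (0 : ℝ) ≤ (cfDen γ n).2 := by positivity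
  have hr : 5 * ((cfDen γ n).2 : ℝ) ≤ 4 * (cfDen γ n).1 := by
    obtain ⟨k, rfl⟩ := Nat.exists_eq_add_of_le' hn
    exact_mod_cast cfDen_snd_le_four_fifths hγ k
  refine cylWeight_le (ρ := 0.0987) hγ hδ (by norm_num) (by norm_num) (by norm_num) ?_
  simp only [cylLength, cfDen, h0, cfDen_congr h]
  push_cast
  refine cylLength_ratio hq hq' (by positivity) hq.le ?_
  nlinarith [mul_nonneg hq.le hq', mul_pos hq hq, mul_nonneg (sub_nonneg.2 hr) hq.le,
    mul_nonneg (sub_nonneg.2 hr) hq']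

theorem cylWeight_two_one {γ δ : ℕ → ℕ} (hγ : Digits γ) (hδ : Digits δ) {n : ℕ}
    (h : ∀ i < n, δ i = γ i) (h0 : δ n = 2) (h1 : δ (n + 1) = 1) :
    cylWeight δ (n + 2) ≤ 0.477 * cylWeight γ n := by
  have hq : (0 : ℝ) < (cfDen γ n).1 := by exact_mod_cast cfDen_pos hγ n
  have hq' : (0 : ℝ) ≤ (cfDen γ n).2 := by positivity
  refine cylWeight_le (ρ := 0.0718) hγ hδ (by norm_num) (by norm_num) (by norm_num) ?_
  simp only [cylLength, cfDen, h0, h1, cfDen_congr h]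
  push_cast
  refine cylLength_ratio hq hq' (by positivity) (by positivity) ?_
  nlinarith [sq_nonneg ((cfDen γ n).2 - 0.732 * (cfDen γ n).1 : ℝ), mul_nonneg hq.le hq',
    mul_pos hq hq]

theorem cylWeight_one_one {γ δ : ℕ → ℕ} (hγ : Digits γ) (hδ : Digits δ) {n : ℕ}
    (h : ∀ i < n, δ i = γ i) (h0 : δ n = 1) (h1 : δ (n + 1) = 1) :
    cylWeight δ (n + 2) ≤ 0.6045 * cylWeight γ n := by
  have hq : (0 : ℝ) < (cfDen γ n).1 := by exact_mod_cast cfDen_pos hγ n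
  have hq' : (0 : ℝ) ≤ (cfDen γ n).2 := by positivity
  refine cylWeight_le (ρ := 1 / 6) hγ hδ (by norm_num) (by norm_num) (by norm_num) ?_
  simp only [cylLength, cfDen, h0, h1, cfDen_congr h]
  push_cast
  refine cylLength_ratio hq hq' (by positivity) (by positivity) ?_
  nlinarith [mul_nonneg hq.le hq', mul_pos hq hq, mul_nonneg hq' hq']

theorem cylWeight_two_three {γ δ : ℕ → ℕ} (hγ : Digits γ) (hδ : Digits δ) {n : ℕ}
    (h : ∀ i < n, δ i = γ i) (h0 : δ n = 2) (h1 : δ (n + 1) = 3) :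
    cylWeight δ (n + 2) ≤ 0.315 * cylWeight γ n := by
  have hq : (0 : ℝ) < (cfDen γ n).1 := by exact_mod_cast cfDen_pos hγ n
  have hq' : (0 : ℝ) ≤ (cfDen γ n).2 := by positivity
  refine cylWeight_le (ρ := 1 / 61) hγ hδ (by norm_num) (by norm_num) (by norm_num) ?_
  simp only [cylLength, cfDen, h0, h1, cfDen_congr h]
  push_cast
  refine cylLength_ratio hq hq' (by positivity) (by positivity) ?_
  nlinarith [sq_nonneg ((cfDen γ n).2 - 0.3 * (cfDen γ n).1 : ℝ), mul_nonneg hq.le hq',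
    mul_pos hq hq]

/-- The restrictions on the branchings of a set of sequences of digits beyond depth `N`. -/
def SparseBranching (S : Set (ℕ → ℕ)) (N : ℕ) : Prop :=
  ∀ γ ∈ S, ∀ δ ∈ S, ∀ n, N ≤ n → (∀ i < n, γ i = δ i) →
    ¬(γ n = 1 ∧ δ n = 3) ∧ (γ n = 2 → δ n = 3 → γ (n + 1) = 1) ∧
      (γ n = 1 → δ n = 2 → γ (n + 1) = 1 ∧ δ (n + 1) = 3)

/-- Covers of a set of sequences by cylinders, given as pairs of a sequence and a depth. -/
def IsCylCover (S : Set (ℕ → ℕ)) (γ : ℕ → ℕ) (n k : ℕ) (L : List ((ℕ → ℕ) × ℕ)) : Prop :=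
  (∀ p ∈ L, p.1 ∈ S ∧ n + k ≤ p.2) ∧
    ∀ δ ∈ S, (∀ i < n, δ i = γ i) → ∃ p ∈ L, ∀ i < p.2, δ i = p.1 i

theorem exists_isCylCover {S : Set (ℕ → ℕ)} {N : ℕ} (hS : ∀ γ ∈ S, Digits γ) (hN : 2 ≤ N)
    (hsplit : SparseBranching S N) (k : ℕ) : ∀ n, N ≤ n → ∀ γ ∈ S, ∃ L, IsCylCover S γ n k L ∧
      (L.map (fun p => cylWeight p.1 p.2)).sum ≤ cylWeight γ n := by
  induction k with
  | zero =>
    intro n _ γ hγ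
    exact ⟨[(γ, n)], ⟨by simpa using hγ, fun δ _ h => ⟨(γ, n), by simp, h⟩⟩, by simp⟩
  | succ k ih =>
    intro n hn γ hγ
    have agree_succ : ∀ {α β : ℕ → ℕ} {m : ℕ}, (∀ i < m, α i = β i) → α m = β m →
        ∀ i < m + 1, α i = β i := by
      intro α β m h1 h2 i hi
      rcases Nat.lt_succ_iff_lt_or_eq.1 hi with h | rfl
      · exact h1 i h
      · exact h2
    have two : ∀ (m₁ m₂ : ℕ) (γ₁ γ₂ : ℕ → ℕ) (a₁ a₂ : ℝ), n + 1 ≤ m₁ → n + 1 ≤ m₂ → γ₁ ∈ S →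
        γ₂ ∈ S → (∀ δ ∈ S, (∀ i < n, δ i = γ i) →
          (∀ i < m₁, δ i = γ₁ i) ∨ (∀ i < m₂, δ i = γ₂ i)) →
        cylWeight γ₁ m₁ ≤ a₁ * cylWeight γ n → cylWeight γ₂ m₂ ≤ a₂ * cylWeight γ n →
        a₁ + a₂ ≤ 1 → ∃ L, IsCylCover S γ n (k + 1) L ∧
          (L.map (fun p => cylWeight p.1 p.2)).sum ≤ cylWeight γ n := by
      intro m₁ m₂ γ₁ γ₂ a₁ a₂ hm₁ hm₂ h₁ h₂ hcov hw₁ hw₂ ha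
      obtain ⟨L₁, ⟨hL₁, hc₁⟩, hs₁⟩ := ih m₁ (by omega) γ₁ h₁
      obtain ⟨L₂, ⟨hL₂, hc₂⟩, hs₂⟩ := ih m₂ (by omega) γ₂ h₂
      refine ⟨L₁ ++ L₂, ⟨?_, ?_⟩, ?_⟩
      · intro p hp
        rcases List.mem_append.1 hp with hp | hp
        · exact ⟨(hL₁ p hp).1, by have := (hL₁ p hp).2; omega⟩
        · exact ⟨(hL₂ p hp).1, by have := (hL₂ p hp).2; omega⟩
      · intro δ hδ h
        rcases hcov δ hδ h with h | h
        · obtain ⟨p, hp, h'⟩ := hc₁ δ hδ h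
          exact ⟨p, List.mem_append_left _ hp, h'⟩
        · obtain ⟨p, hp, h'⟩ := hc₂ δ hδ h
          exact ⟨p, List.mem_append_right _ hp, h'⟩
      · rw [List.map_append, List.sum_append]
        have : 0 ≤ cylWeight γ n := Real.rpow_nonneg (cylLength_pos (hS γ hγ) n).le _
        nlinarith
    by_cases h23 : ∃ α ∈ S, ∃ β ∈ S, (∀ i < n, α i = γ i) ∧ (∀ i < n, β i = γ i) ∧
        α n = 2 ∧ β n = 3
    · obtain ⟨α, hα, β, hβ, hαγ, hβγ, hα2, hβ3⟩ := h23
      have key : ∀ δ ∈ S, (∀ i < n, δ i = γ i) → δ n = 2 → δ (n + 1) = 1 := fun δ hδ h h2 =>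
        (hsplit δ hδ β hβ n hn (fun i hi => (h i hi).trans (hβγ i hi).symm)).2.1 h2 hβ3
      refine two (n + 2) (n + 1) α β 0.477 0.5225 (by omega) le_rfl hα hβ ?_
        (cylWeight_two_one (hS γ hγ) (hS α hα) hαγ hα2 (key α hα hαγ hα2))
        (cylWeight_three (hS γ hγ) (hS β hβ) (by omega) hβγ hβ3) (by norm_num)
      intro δ hδ h
      rcases (hS δ hδ).cases n with h1 | h2 | h3
      · exact absurd ⟨h1, hβ3⟩
          (hsplit δ hδ β hβ n hn (fun i hi => (h i hi).trans (hβγ i hi).symm)).1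
      · left
        exact agree_succ (agree_succ (fun i hi => (h i hi).trans (hαγ i hi).symm)
          (h2.trans hα2.symm)) ((key δ hδ h h2).trans (key α hα hαγ hα2).symm)
      · right
        exact agree_succ (fun i hi => (h i hi).trans (hβγ i hi).symm) (h3.trans hβ3.symm)
    by_cases h12 : ∃ α ∈ S, ∃ β ∈ S, (∀ i < n, α i = γ i) ∧ (∀ i < n, β i = γ i) ∧
        α n = 1 ∧ β n = 2
    · obtain ⟨α, hα, β, hβ, hαγ, hβγ, hα1, hβ2⟩ := h12
      have key1 : ∀ δ ∈ S, (∀ i < n, δ i = γ i) → δ n = 1 → δ (n + 1) = 1 := fun δ hδ h h1 =>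
        ((hsplit δ hδ β hβ n hn (fun i hi => (h i hi).trans (hβγ i hi).symm)).2.2 h1 hβ2).1
      have key2 : ∀ δ ∈ S, (∀ i < n, δ i = γ i) → δ n = 2 → δ (n + 1) = 3 := fun δ hδ h h2 =>
        ((hsplit α hα δ hδ n hn (fun i hi => (hαγ i hi).trans (h i hi).symm)).2.2 hα1 h2).2
      refine two (n + 2) (n + 2) α β 0.6045 0.315 (by omega) (by omega) hα hβ ?_
        (cylWeight_one_one (hS γ hγ) (hS α hα) hαγ hα1 (key1 α hα hαγ hα1))
        (cylWeight_two_three (hS γ hγ) (hS β hβ) hβγ hβ2 (key2 β hβ hβγ hβ2)) (by norm_num)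
      intro δ hδ h
      rcases (hS δ hδ).cases n with h1 | h2 | h3
      · left
        exact agree_succ (agree_succ (fun i hi => (h i hi).trans (hαγ i hi).symm)
          (h1.trans hα1.symm)) ((key1 δ hδ h h1).trans (key1 α hα hαγ hα1).symm)
      · right
        exact agree_succ (agree_succ (fun i hi => (h i hi).trans (hβγ i hi).symm)
          (h2.trans hβ2.symm)) ((key2 δ hδ h h2).trans (key2 β hβ hβγ hβ2).symm)
      · exact absurd ⟨β, hβ, δ, hδ, hβγ, h, hβ2, h3⟩ h23
    · obtain ⟨L, ⟨hL, hc⟩, hs⟩ := ih (n + 1) (by omega) γ hγ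
      refine ⟨L, ⟨fun p hp => ⟨(hL p hp).1, by have := (hL p hp).2; omega⟩, ?_⟩,
        hs.trans (cylWeight_succ_le (hS γ hγ) n)⟩
      intro δ hδ h
      refine hc δ hδ (agree_succ h ?_)
      have hs1 := (hsplit δ hδ γ hγ n hn h).1
      have hs2 := (hsplit γ hγ δ hδ n hn (fun i hi => (h i hi).symm)).1
      have hγγ : ∀ i < n, γ i = γ i := fun _ _ => rfl
      rcases (hS δ hδ).cases n with h1 | h1 | h1 <;> rcases (hS γ hγ).cases n with h2 | h2 | h2
      · rw [h1, h2]
      · exact absurd ⟨δ, hδ, γ, hγ, h, hγγ, h1, h2⟩ h12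
      · exact absurd ⟨h1, h2⟩ hs1
      · exact absurd ⟨γ, hγ, δ, hδ, hγγ, h, h2, h1⟩ h12
      · rw [h1, h2]
      · exact absurd ⟨δ, hδ, γ, hγ, h, hγγ, h1, h2⟩ h23
      · exact absurd ⟨h2, h1⟩ hs2
      · exact absurd ⟨γ, hγ, δ, hδ, hγγ, h, h2, h1⟩ h23
      · rw [h1, h2]

open MeasureTheory in
/-- A set of continued fractions with sparse branching has dimension at most `9 / 32`. -/
theorem dimH_cfVal_image_le {S : Set (ℕ → ℕ)} {N : ℕ} (hS : ∀ γ ∈ S, Digits γ) (hN : 2 ≤ N)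
    (hagree : ∀ γ ∈ S, ∀ δ ∈ S, ∀ i < N, γ i = δ i) (hsplit : SparseBranching S N) :
    dimH (cfVal '' S) ≤ ((9 / 32 : NNReal) : ENNReal) := by
  rcases S.eq_empty_or_nonempty with rfl | ⟨γ, hγ⟩
  · simp
  choose L hL hLs using fun k => exists_isCylCover hS hN hsplit k N le_rfl γ hγ
  have hdiam : ∀ (β : ℕ → ℕ) (m : ℕ) (r : ℝ), (∀ α ∈ S, ∀ δ ∈ S, (∀ i < m, α i = β i) →
      (∀ i < m, δ i = β i) → |cfVal α - cfVal δ| ≤ r) →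
      Metric.ediam (cfVal '' {δ ∈ S | ∀ i < m, δ i = β i}) ≤ ENNReal.ofReal r := by
    intro β m r h
    refine Metric.ediam_le ?_
    rintro _ ⟨α, ⟨hα, hαβ⟩, rfl⟩ _ ⟨δ, ⟨hδ, hδβ⟩, rfl⟩
    rw [edist_dist, Real.dist_eq]
    exact ENNReal.ofReal_le_ofReal (h α hα δ hδ hαβ hδβ)
  refine dimH_le_of_hausdorffMeasure_ne_top (ne_top_of_le_ne_top
    (ENNReal.ofReal_ne_top (r := cylWeight γ N)) ?_)
  refine (Measure.hausdorffMeasure_le_liminf_sum (ι := fun k => Fin (L k).length) _ _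
    (l := atTop) (fun k : ℕ => ENNReal.ofReal ((16 / 25) ^ k)) ?_
    (fun k i => cfVal '' {δ ∈ S | ∀ j < ((L k).get i).2, δ j = ((L k).get i).1 j}) ?_ ?_).trans ?_
  · rw [← ENNReal.ofReal_zero]
    exact ENNReal.tendsto_ofReal
      (tendsto_pow_atTop_nhds_zero_of_lt_one (by norm_num) (by norm_num))
  · refine Eventually.of_forall fun k i => hdiam _ _ _ fun α hα δ hδ hαβ hδβ => ?_
    refine (cfVal_dist (hS α hα) (hS δ hδ) (n := k) fun j hj => ?_)
    have := ((hL k).1 _ (List.get_mem (L k) i)).2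
    rw [hαβ j (by omega), hδβ j (by omega)]
  · refine Eventually.of_forall fun k => ?_
    rintro _ ⟨δ, hδ, rfl⟩
    obtain ⟨p, hp, h⟩ := (hL k).2 δ hδ (hagree δ hδ γ hγ)
    obtain ⟨i, rfl⟩ := List.get_of_mem hp
    exact Set.mem_iUnion.2 ⟨i, δ, ⟨hδ, h⟩, rfl⟩
  · refine liminf_le_of_le (by isBoundedDefault) fun b hb => ?_
    obtain ⟨k, hk⟩ := hb.exists
    refine hk.trans ?_
    calc _ ≤ ∑ i : Fin (L k).length,
          ENNReal.ofReal (cylWeight ((L k).get i).1 ((L k).get i).2) := by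
          refine Finset.sum_le_sum fun i _ => ?_
          have hβ := hS _ ((hL k).1 _ (List.get_mem (L k) i)).1
          rw [cylWeight, ← ENNReal.ofReal_rpow_of_nonneg (cylLength_pos hβ _).le (by norm_num)]
          push_cast
          refine ENNReal.rpow_le_rpow (hdiam _ _ _ fun α hα δ hδ hαβ hδβ => ?_) (by norm_num)
          rw [← cylLength_congr hαβ]
          exact cfVal_dist_le_cylLength (hS α hα) (hS δ hδ)
            fun j hj => (hαβ j hj).trans (hδβ j hj).symm
      _ = ENNReal.ofReal (∑ i : Fin (L k).length,
          cylWeight ((L k).get i).1 ((L k).get i).2) := by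
          rw [ENNReal.ofReal_sum_of_nonneg]
          intro i _
          have hβ := hS _ ((hL k).1 _ (List.get_mem (L k) i)).1
          exact Real.rpow_nonneg (cylLength_pos hβ _).le _
      _ = ENNReal.ofReal (((L k).map (fun p => cylWeight p.1 p.2)).sum) := by
          congr 1
          conv_rhs => rw [← List.ofFn_get (L k), List.map_ofFn]
          rw [← List.sum_ofFn]
          rfl
      _ ≤ _ := ENNReal.ofReal_le_ofReal (hLs k)

theorem formInf_le {a b c : ℝ} {x y : ℤ} (h : (x, y) ≠ (0, 0)) :
    formInf a b c ≤ |a * (x : ℝ) ^ 2 + b * (x : ℝ) * (y : ℝ) + c * (y : ℝ) ^ 2| :=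
  ciInf_le (f := fun v : {v : ℤ × ℤ // v ≠ (0, 0)} =>
    |a * (v.1.1 : ℝ) ^ 2 + b * (v.1.1 : ℝ) * (v.1.2 : ℝ) + c * (v.1.2 : ℝ) ^ 2|)
    ⟨0, by rintro _ ⟨v, rfl⟩; exact abs_nonneg _⟩ ⟨(x, y), h⟩

/-- The forms of discriminant one with `|b| ≤ |a|` whose nonzero values are at least `μ`. -/
def boundedForms (μ : ℝ) : Set (ℝ × ℝ × ℝ) :=
  {F | F.2.1 ^ 2 - 4 * F.1 * F.2.2 = 1 ∧ |F.2.1| ≤ |F.1| ∧ ∀ x y : ℤ, (x, y) ≠ (0, 0) →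
    μ ≤ |F.1 * (x : ℝ) ^ 2 + F.2.1 * (x : ℝ) * (y : ℝ) + F.2.2 * (y : ℝ) ^ 2|}

theorem isClosed_boundedForms (μ : ℝ) : IsClosed (boundedForms μ) := by
  have h1 : IsClosed {F : ℝ × ℝ × ℝ | F.2.1 ^ 2 - 4 * F.1 * F.2.2 = 1} :=
    isClosed_eq (by fun_prop) (by fun_prop)
  have h2 : IsClosed {F : ℝ × ℝ × ℝ | |F.2.1| ≤ |F.1|} :=
    isClosed_le (by fun_prop) (by fun_prop)
  have h3 : ∀ x y : ℤ, IsClosed {F : ℝ × ℝ × ℝ |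
      μ ≤ |F.1 * (x : ℝ) ^ 2 + F.2.1 * (x : ℝ) * (y : ℝ) + F.2.2 * (y : ℝ) ^ 2|} :=
    fun x y => isClosed_le (by fun_prop) (by fun_prop)
  convert h1.inter (h2.inter (isClosed_iInter fun x => isClosed_iInter fun y =>
    isClosed_iInter fun _ : (x, y) ≠ (0, 0) => h3 x y)) using 1
  ext F
  simp [boundedForms]

/-- A form takes each of its primitive values as the leading coefficient of an equivalent form
with a small middle coefficient. -/
theorem exists_boundedForm {a b c : ℝ} (hd : b ^ 2 - 4 * a * c = 1) (hμ : 0 < formInf a b c)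
    {ε : ℝ} (hε : 0 < ε) :
    ∃ F ∈ boundedForms (formInf a b c), |F.1| < formInf a b c + ε := by
  set μ := formInf a b c with hμdef
  have : Nonempty {v : ℤ × ℤ // v ≠ (0, 0)} := ⟨⟨(1, 0), by simp⟩⟩
  obtain ⟨⟨⟨x, y⟩, hv⟩, hlt⟩ := exists_lt_of_ciInf_lt (show formInf a b c < μ + ε by linarith)
  simp only at hlt
  have hg : 0 < Int.gcd x y := by
    rw [Int.gcd_pos_iff]
    by_contra! h
    exact hv (by rw [h.1, h.2])
  obtain ⟨p, q, hpq, hx, hy⟩ := Int.exists_gcd_one hg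
  obtain ⟨u, w, huw⟩ := Int.isCoprime_iff_gcd_eq_one.2 hpq
  have hpq0 : (p, q) ≠ (0, 0) := by
    intro h
    simp only [Prod.mk.injEq] at h
    rw [h.1, h.2] at huw
    simp at huw
  have hd1 : (1 : ℝ) ≤ Int.gcd x y := by exact_mod_cast hg
  set A := a * (p : ℝ) ^ 2 + b * (p : ℝ) * (q : ℝ) + c * (q : ℝ) ^ 2 with hA
  have hAμ : μ ≤ |A| := formInf_le hpq0
  have hAlt : |A| < μ + ε := by
    refine lt_of_le_of_lt ?_ hlt
    have : a * (x : ℝ) ^ 2 + b * (x : ℝ) * (y : ℝ) + c * (y : ℝ) ^ 2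
        = (Int.gcd x y : ℝ) ^ 2 * A := by
      have hx' : (x : ℝ) = p * (Int.gcd x y : ℝ) := by exact_mod_cast hx
      have hy' : (y : ℝ) = q * (Int.gcd x y : ℝ) := by exact_mod_cast hy
      rw [hx', hy', hA]
      ring
    rw [this, abs_mul, abs_pow, Nat.abs_cast]
    exact le_mul_of_one_le_left (abs_nonneg _) (one_le_pow₀ hd1)
  have hA0 : A ≠ 0 := fun h => by rw [h, abs_zero] at hAμ; linarith
  have huw' : (u : ℝ) * p + w * q = 1 := by exact_mod_cast huw
  set B₀ := 2 * a * p * (-w) + b * (p * u + q * (-w)) + 2 * c * q * u with hB₀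
  set n : ℤ := -round (B₀ / (2 * A)) with hn
  set r : ℤ := -w + n * p with hr
  set s : ℤ := u + n * q with hs
  have hrR : (r : ℝ) = -w + n * p := by rw [hr]; push_cast; ring
  have hsR : (s : ℝ) = u + n * q := by rw [hs]; push_cast; ring
  set B := 2 * a * p * r + b * (p * s + q * r) + 2 * c * q * s with hB
  set C := a * (r : ℝ) ^ 2 + b * (r : ℝ) * (s : ℝ) + c * (s : ℝ) ^ 2 with hC
  have hdet : (p : ℝ) * s - q * r = 1 := by rw [hrR, hsR]; linear_combination huw'
  have hBn : B = B₀ + 2 * n * A := by rw [hB, hB₀, hA, hrR, hsR]; ring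
  refine ⟨(A, B, C), ⟨?_, ?_, ?_⟩, hAlt⟩
  · have : B ^ 2 - 4 * A * C = ((p : ℝ) * s - q * r) ^ 2 * (b ^ 2 - 4 * a * c) := by
      rw [hB, hA, hC]; ring
    simp only
    rw [this, hdet, hd]; norm_num
  · simp only
    have h1 := abs_sub_round (B₀ / (2 * A))
    have h2 : B = (B₀ / (2 * A) - round (B₀ / (2 * A))) * (2 * A) := by
      rw [hBn, hn, sub_mul, div_mul_cancel₀ _ (by simpa using hA0)]
      push_cast
      ring
    rw [h2, abs_mul, abs_mul, abs_two]
    nlinarith [abs_nonneg A]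
  · intro x' y' h'
    simp only
    have hne : (p * x' + r * y', q * x' + s * y') ≠ (0, 0) := by
      intro h
      simp only [Prod.mk.injEq] at h
      have hdetZ : p * s - q * r = 1 := by exact_mod_cast hdet
      apply h'
      ext
      · simp only
        linear_combination s * h.1 - r * h.2 - x' * hdetZ
      · simp only
        linear_combination p * h.2 - q * h.1 - y' * hdetZ
    refine (formInf_le (a := a) (b := b) (c := c) hne).trans (le_of_eq ?_)
    congr 1
    push_cast
    rw [hA, hB, hC]
    ring

/-- The infimum in the definition of the Markov spectrum is attained by the leading coefficient of
a suitable form with the same infimum. -/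
theorem exists_minimal_form {m : ℝ} (hm : m ∈ markovSpectrum) :
    ∃ A B C : ℝ, B ^ 2 - 4 * A * C = 1 ∧ 0 < A ∧ m = 1 / A ∧ ∀ x y : ℤ, (x, y) ≠ (0, 0) →
      A ≤ |A * (x : ℝ) ^ 2 + B * (x : ℝ) * (y : ℝ) + C * (y : ℝ) ^ 2| := by
  obtain ⟨a, b, c, hd, hμ, rfl⟩ := hm
  set μ := formInf a b c with hμdef
  have hlow : ∀ F ∈ boundedForms μ, μ ≤ |F.1| := by
    intro F hF
    have := hF.2.2 1 0 (by simp)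
    simpa using this
  have hcomp : IsCompact (boundedForms μ ∩ {F | |F.1| ≤ μ + 1}) := by
    refine Metric.isCompact_of_isClosed_isBounded ((isClosed_boundedForms μ).inter
      (isClosed_le (by fun_prop) (by fun_prop))) ?_
    set R := μ + 1 + ((μ + 1) ^ 2 + 1) / (4 * μ) with hR
    refine (Metric.isBounded_Icc ((-R, -R, -R) : ℝ × ℝ × ℝ) (R, R, R)).subset ?_
    rintro ⟨A, B, C⟩ ⟨hF, hA⟩
    have h1 := hlow _ hF
    obtain ⟨h2, h3, -⟩ := hF
    simp only at h1 h2 h3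
    change |A| ≤ μ + 1 at hA
    have hC : |C| ≤ ((μ + 1) ^ 2 + 1) / (4 * μ) := by
      rw [le_div_iff₀ (by positivity)]
      have h4 : |C| * (4 * |A|) = |B ^ 2 - 1| := by
        rw [show B ^ 2 - 1 = C * (4 * A) by linarith, abs_mul, abs_mul,
          abs_of_pos (four_pos : (0 : ℝ) < 4)]
      have h5 : |B ^ 2 - 1| ≤ (μ + 1) ^ 2 + 1 := by
        have : B ^ 2 ≤ (μ + 1) ^ 2 := by
          rw [← sq_abs B]
          exact pow_le_pow_left₀ (abs_nonneg _) (h3.trans hA) 2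
        rw [abs_le]
        constructor <;> nlinarith [sq_nonneg B]
      nlinarith [abs_nonneg C]
    have h6 : 0 ≤ ((μ + 1) ^ 2 + 1) / (4 * μ) := by positivity
    have hA' := abs_le.1 hA
    have hB' := abs_le.1 (h3.trans hA)
    have hC' := abs_le.1 hC
    refine ⟨⟨?_, ?_, ?_⟩, ⟨?_, ?_, ?_⟩⟩ <;> simp only <;> linarith
  obtain ⟨F₀, hF₀, hF₀lt⟩ := exists_boundedForm hd hμ one_pos
  obtain ⟨⟨A, B, C⟩, ⟨hF, -⟩, hmin⟩ := hcomp.exists_isMinOn ⟨F₀, hF₀, hF₀lt.le⟩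
    (f := fun F => |F.1|) (by fun_prop)
  have hAμ : |A| = μ := by
    refine le_antisymm (le_of_forall_pos_lt_add fun ε hε => ?_) (hlow _ hF)
    obtain ⟨F, hF', hlt⟩ := exists_boundedForm hd hμ (lt_min hε one_pos)
    have h1 : |F.1| < μ + ε := hlt.trans_le (by gcongr; exact min_le_left _ _)
    have h2 : |F.1| ≤ μ + 1 := hlt.le.trans (by gcongr; exact min_le_right _ _)
    exact (hmin ⟨hF', h2⟩).trans_lt h1
  obtain ⟨h1, -, h3⟩ := hF
  simp only at h1 h3
  rcases abs_cases A with ⟨h, h0⟩ | ⟨h, h0⟩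
  · have hA : A = μ := by linarith
    exact ⟨A, B, C, h1, by linarith, by rw [hA], fun x y hxy => hA.le.trans (h3 x y hxy)⟩
  · have hA : -A = μ := by linarith
    refine ⟨-A, -B, -C, by linarith, by linarith, by rw [hA], fun x y hxy => ?_⟩
    have := h3 x y hxy
    rw [← abs_neg] at this
    calc -A = μ := hA
      _ ≤ _ := this
      _ = _ := by congr 1; ring

/-- The values of the form with roots `α` and `β` at nonzero integer vectors are at least `1 / m`,
relative to the square root of the discriminant. -/
def RootsBound (m α β : ℝ) : Prop :=
  ∀ x y : ℤ, (x, y) ≠ (0, 0) → |α - β| ≤ m * |(x - α * y) * (x - β * y)|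

theorem RootsBound.step {m α β α' β' : ℝ} (h : RootsBound m α β) {a : ℤ}
    (hα : α' * (α - a) = 1) (hβ : β' * (β - a) = 1) : RootsBound m α' β' := by
  intro x y hxy
  have hne : (a * x + y, x) ≠ (0, 0) := by
    intro h0
    simp only [Prod.mk.injEq] at h0
    apply hxy
    have h1 := h0.1
    rw [h0.2] at h1 ⊢
    simp at h1
    rw [h1]
  have h1 := h _ _ hne
  have e1 : α' - β' = -(α' * β') * (α - β) := by linear_combination β' * hα - α' * hβ
  have e2 : (x - α' * y) * (x - β' * y) =
      (α' * β') * (((a * x + y : ℤ) - α * x) * ((a * x + y : ℤ) - β * x)) := by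
    have e3 : (x - α' * y) = -α' * ((a * x + y : ℤ) - α * x) := by
      push_cast; linear_combination (-(x : ℝ)) * hα
    have e4 : (x - β' * y) = -β' * ((a * x + y : ℤ) - β * x) := by
      push_cast; linear_combination (-(x : ℝ)) * hβ
    rw [e3, e4]; ring
  rw [e1, e2, abs_mul, abs_neg, abs_mul (α' * β')]
  nlinarith [abs_nonneg (α' * β')]

theorem RootsBound.step_symm {m α β α' β' : ℝ} (h : RootsBound m α' β') {a : ℤ}
    (hα : α' * (α - a) = 1) (hβ : β' * (β - a) = 1) : RootsBound m α β := by
  intro x y hxy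
  have hne : (y, x - a * y) ≠ (0, 0) := by
    intro h0
    simp only [Prod.mk.injEq] at h0
    apply hxy
    have h1 := h0.2
    rw [h0.1] at h1 ⊢
    simp at h1
    rw [h1]
  have h1 := h _ _ hne
  have e1 : α - β = -((α - a) * (β - a)) * (α' - β') := by
    linear_combination (-(α - a)) * hβ + (β - a) * hα
  have e2 : (x - α * y) * (x - β * y) =
      ((α - a) * (β - a)) * ((y - α' * (x - a * y : ℤ)) * (y - β' * (x - a * y : ℤ))) := by
    have e3 : (x - α * y) = -(α - a) * (y - α' * (x - a * y : ℤ)) := by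
      push_cast; linear_combination (-((x : ℝ) - a * y)) * hα
    have e4 : (x - β * y) = -(β - a) * (y - β' * (x - a * y : ℤ)) := by
      push_cast; linear_combination (-((x : ℝ) - a * y)) * hβ
    rw [e3, e4]; ring
  rw [e1, e2, abs_mul, abs_neg, abs_mul ((α - a) * (β - a))]
  nlinarith [abs_nonneg ((α - a) * (β - a))]

theorem RootsBound.ne_zero {m α β : ℝ} (h : RootsBound m α β) (hαβ : α ≠ β) {x y : ℤ}
    (hxy : (x, y) ≠ (0, 0)) : (x - α * y : ℝ) ≠ 0 ∧ (x - β * y : ℝ) ≠ 0 := by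
  have h1 := h x y hxy
  have h2 : 0 < |α - β| := abs_pos.2 (sub_ne_zero.2 hαβ)
  constructor <;> intro h0 <;> rw [h0] at h1 <;> simp at h1 <;> exact hαβ (sub_eq_zero.1 h1)

/-- Reduced pairs of roots. -/
def ReducedRoots (m : ℝ) (z : ℝ × ℝ) : Prop :=
  1 < z.1 ∧ -1 < z.2 ∧ z.2 < 0 ∧ RootsBound m z.1 z.2

theorem exists_reducedRoots {m : ℝ} (hm : m ∈ markovSpectrum) (h2 : 2 < m) :
    ∃ z, ReducedRoots m z ∧ z.1 - z.2 = m := by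
  obtain ⟨A, B, C, hd, hA, rfl, hmin⟩ := exists_minimal_form hm
  set α := (-B + 1) / (2 * A) with hα
  set β := (-B - 1) / (2 * A) with hβ
  have hαβ : α - β = 1 / A := by rw [hα, hβ]; field_simp; ring
  have hC : C = A * (α * β) := by
    rw [hα, hβ]; field_simp; linarith
  have hB : B = -A * (α + β) := by
    rw [hα, hβ]; field_simp; ring
  have hbd : RootsBound (1 / A) α β := by
    intro x y hxy
    have h1 := hmin x y hxy
    have e : A * (x : ℝ) ^ 2 + B * (x : ℝ) * (y : ℝ) + C * (y : ℝ) ^ 2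
        = A * ((x - α * y) * (x - β * y)) := by
      rw [hC, hB]; ring
    rw [e, abs_mul, abs_of_pos hA] at h1
    have h3 : 1 ≤ |(x - α * y) * (x - β * y)| := by
      by_contra! h
      nlinarith
    rw [hαβ, abs_of_pos (by positivity)]
    exact le_mul_of_one_le_right (by positivity) h3
  have hne : α ≠ β := fun h => by rw [h, sub_self] at hαβ; linarith
  have h3 := (hbd.ne_zero hne (x := ⌊β⌋) (y := 1) (by simp)).2
  have h4 := Int.floor_le β
  have h5 := Int.lt_floor_add_one β
  have h6 : (⌊β⌋ : ℝ) < β := lt_of_le_of_ne h4 fun h => h3 (by push_cast; linarith)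
  refine ⟨(α - (⌊β⌋ + 1 : ℤ), β - (⌊β⌋ + 1 : ℤ)), ⟨?_, ?_, ?_, ?_⟩, ?_⟩
  · push_cast; linarith
  · push_cast; linarith
  · push_cast; linarith
  · intro x y hxy
    have hne' : (x + (⌊β⌋ + 1) * y, y) ≠ (0, 0) := by
      intro h
      simp only [Prod.mk.injEq] at h
      apply hxy
      have h1 := h.1
      rw [h.2] at h1 ⊢
      simp at h1
      rw [h1]
    have := hbd _ _ hne'
    rw [show α - (⌊β⌋ + 1 : ℤ) - (β - (⌊β⌋ + 1 : ℤ)) = α - β by ring]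
    refine this.trans (le_of_eq ?_)
    congr 2
    push_cast
    ring
  · simp only; linarith

theorem ReducedRoots.succ {m : ℝ} {z : ℝ × ℝ} (h : ReducedRoots m z) :
    ∃ w, ReducedRoots m w ∧ ∃ a : ℤ, w.1 * (z.1 - a) = 1 ∧ w.2 * (z.2 - a) = 1 := by
  obtain ⟨α, β⟩ := z
  obtain ⟨h1, h2, h3, h4⟩ := h
  simp only at h1 h2 h3 h4
  have h5 := (h4.ne_zero (by linarith : α ≠ β) (x := ⌊α⌋) (y := 1) (by simp)).1
  have h6 : (⌊α⌋ : ℝ) < α := lt_of_le_of_ne (Int.floor_le α) fun h => h5 (by push_cast; linarith)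
  have h7 := Int.lt_floor_add_one α
  have h8 : (1 : ℝ) ≤ ⌊α⌋ := by exact_mod_cast Int.le_floor.2 (by exact_mod_cast h1.le)
  have e1 : 1 / (α - ⌊α⌋) * (α - ⌊α⌋) = 1 := one_div_mul_cancel (by linarith)
  have e2 : 1 / (β - ⌊α⌋) * (β - ⌊α⌋) = 1 := one_div_mul_cancel (by linarith)
  refine ⟨(1 / (α - ⌊α⌋), 1 / (β - ⌊α⌋)), ⟨?_, ?_, ?_, h4.step e1 e2⟩, ⌊α⌋, e1, e2⟩
  · simp only
    rw [lt_div_iff₀ (by linarith)]; linarith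
  · simp only
    rw [lt_div_iff_of_neg (by linarith)]; linarith
  · simp only
    exact one_div_neg.2 (by linarith)

theorem ReducedRoots.pred {m : ℝ} {w : ℝ × ℝ} (h : ReducedRoots m w) :
    ∃ z, ReducedRoots m z ∧ ∃ a : ℤ, w.1 * (z.1 - a) = 1 ∧ w.2 * (z.2 - a) = 1 := by
  obtain ⟨α, β⟩ := w
  obtain ⟨h1, h2, h3, h4⟩ := h
  simp only at h1 h2 h3 h4
  have hb : 1 < 1 / (-β) := by rw [lt_div_iff₀ (by linarith)]; linarith
  set a := ⌊1 / (-β)⌋ with ha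
  have h7 := Int.lt_floor_add_one (1 / (-β))
  have h8 : (1 : ℝ) ≤ a := by exact_mod_cast Int.le_floor.2 (by exact_mod_cast hb.le)
  have hβ' : 1 / (-β) = -(1 / β) := by rw [one_div, one_div, inv_neg]
  rw [hβ', ← hβ', ← ha] at h7
  have hβ1 : β * (1 / β) = 1 := mul_one_div_cancel h3.ne
  have hα1 : α * (1 / α) = 1 := mul_one_div_cancel (by linarith)
  have e1 : α * (a + 1 / α - a) = 1 := by linear_combination hα1
  have e2 : β * (a + 1 / β - a) = 1 := by linear_combination hβ1
  have h6 : (a : ℝ) < 1 / (-β) := by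
    refine lt_of_le_of_ne (Int.floor_le _) fun h => ?_
    refine (h4.ne_zero (by linarith : α ≠ β) (x := -1) (y := a) (by simp)).2 ?_
    rw [h]
    push_cast
    linear_combination (-β) * hβ' + hβ1
  have hα0 : 0 < 1 / α := by positivity
  refine ⟨(a + 1 / α, a + 1 / β), ⟨?_, ?_, ?_, h4.step_symm e1 e2⟩, a, e1, e2⟩
  · simp only; linarith
  · simp only; linarith
  · simp only; linarith

theorem exists_int_orbit {X : Type*} {P : X → Prop} {R : X → X → Prop}
    (hs : ∀ x, P x → ∃ y, P y ∧ R x y) (hp : ∀ y, P y → ∃ x, P x ∧ R x y) {x₀ : X} (h₀ : P x₀) :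
    ∃ f : ℤ → X, f 0 = x₀ ∧ ∀ i, P (f i) ∧ R (f i) (f (i + 1)) := by
  choose s hs using fun x : {x // P x} => hs x.1 x.2
  choose p hp using fun x : {x // P x} => hp x.1 x.2
  let S : {x // P x} → {x // P x} := fun x => ⟨s x, (hs x).1⟩
  let Q : {x // P x} → {x // P x} := fun x => ⟨p x, (hp x).1⟩
  let f : ℤ → {x // P x} := fun i => match i with
    | Int.ofNat n => S^[n] ⟨x₀, h₀⟩
    | Int.negSucc n => Q^[n + 1] ⟨x₀, h₀⟩
  refine ⟨fun i => (f i).1, rfl, fun i => ⟨(f i).2, ?_⟩⟩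
  match i with
  | Int.ofNat n =>
    have : f (Int.ofNat n + 1) = S (f (Int.ofNat n)) := Function.iterate_succ_apply' S n _
    change R (f (Int.ofNat n)).1 (f (Int.ofNat n + 1)).1
    rw [this]
    exact (hs _).2
  | Int.negSucc 0 => exact (hp _).2
  | Int.negSucc (n + 1) =>
    have : f (Int.negSucc (n + 1)) = Q (f (Int.negSucc (n + 1) + 1)) :=
      Function.iterate_succ_apply' Q (n + 1) _
    change R (f (Int.negSucc (n + 1))).1 (f (Int.negSucc (n + 1) + 1)).1
    rw [this]
    exact (hp _).2

/-- The continued fraction recursions attached to an element of the Markov spectrum. -/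
theorem exists_markov_orbit {m : ℝ} (hm : m ∈ markovSpectrum) (h2 : 2 < m) :
    ∃ (a : ℤ → ℤ) (X Y : ℤ → ℝ), (∀ i, 0 < X i ∧ X i < 1) ∧ (∀ i, 0 < Y i ∧ Y i < 1) ∧
      (∀ i, X i * (a i + X (i + 1)) = 1) ∧ (∀ i, Y (i + 1) * (a i + Y i) = 1) ∧
      (∀ i, a i + X (i + 1) + Y i ≤ m) ∧ a 0 + X (0 + 1) + Y 0 = m := by
  obtain ⟨z, hz, hzm⟩ := exists_reducedRoots hm h2
  obtain ⟨f, h0, hf⟩ := exists_int_orbit (P := ReducedRoots m)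
    (R := fun z w => ∃ a : ℤ, w.1 * (z.1 - a) = 1 ∧ w.2 * (z.2 - a) = 1)
    (fun z hz => hz.succ) (fun w hw => hw.pred) hz
  choose a ha using fun i => (hf i).2
  have hX : ∀ i, a i + 1 / (f (i + 1)).1 = (f i).1 := fun i => by
    have h1 := (hf (i + 1)).1.1
    have := (ha i).1
    field_simp
    linarith
  refine ⟨a, fun i => 1 / (f i).1, fun i => -(f i).2, fun i => ?_, fun i => ?_, fun i => ?_,
    fun i => ?_, fun i => ?_, ?_⟩
  · have := (hf i).1.1
    exact ⟨by positivity, by rw [div_lt_one (by linarith)]; exact this⟩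
  · have := (hf i).1
    exact ⟨by linarith [this.2.2.1], by linarith [this.2.1]⟩
  · simp only
    rw [hX]
    exact one_div_mul_cancel (by linarith [(hf i).1.1])
  · linear_combination (ha i).2
  · simp only
    rw [hX]
    have := (hf i).1.2.2.2 1 0 (by simp)
    simp only [Int.cast_one, Int.cast_zero, mul_zero, sub_zero, mul_one, abs_one] at this
    linarith [le_abs_self ((f i).1 - (f i).2)]
  · simp only
    rw [hX, h0]
    linarith

theorem eq_of_recursion_four {Z : ℕ → ℝ} (hZ : ∀ n, 0 < Z n ∧ Z n < 1)
    (h : ∀ n, Z n * (4 + Z (n + 1)) = 1) : Z 0 = √5 - 2 := by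
  have h5 : √5 ^ 2 = 5 := Real.sq_sqrt (by norm_num)
  have hs0 : 2 < √5 := by rw [Real.lt_sqrt (by norm_num)]; norm_num
  have hs1 : √5 < 9 / 4 := by rw [Real.sqrt_lt' (by norm_num)]; norm_num
  have key : ∀ n k, |Z k - (√5 - 2)| ≤ (1 / 4) ^ n := by
    intro n
    induction n with
    | zero =>
      intro k
      rw [pow_zero, abs_le]
      constructor <;> linarith [hZ k]
    | succ n ih =>
      intro k
      have e : Z k - (√5 - 2) = -(Z k * (√5 - 2)) * (Z (k + 1) - (√5 - 2)) := by
        linear_combination (√5 - 2) * h k - Z k * h5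
      have e1 : |-(Z k * (√5 - 2))| ≤ 1 / 4 := by
        rw [abs_neg, abs_of_nonneg (mul_nonneg (hZ k).1.le (by linarith))]
        nlinarith [hZ k]
      rw [e, abs_mul, pow_succ']
      exact mul_le_mul e1 (ih _) (abs_nonneg _) (by norm_num)
  have h0 : |Z 0 - (√5 - 2)| ≤ 0 := ge_of_tendsto'
    (tendsto_pow_atTop_nhds_zero_of_lt_one (by norm_num) (by norm_num)) (fun n => key n 0)
  exact sub_eq_zero.1 (abs_nonpos_iff.1 h0)

/-- The value `[a i; a (i + 1), …] + [0; a (i - 1), …]` of a two-sided sequence at the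
position `i`. -/
noncomputable def cfSum (a : ℤ → ℕ) (i : ℤ) : ℝ :=
  a i + cfVal (fun k : ℕ => a (i + 1 + k)) + cfVal (fun k : ℕ => a (i - 1 - k))

/-- An element of the Markov spectrum below `√20` comes from a two-sided sequence of digits
`1, 2, 3`. -/
theorem exists_digits_of_mem_markovSpectrum {m : ℝ} (hm : m ∈ markovSpectrum) (h2 : 2 < m)
    (h20 : m < √20) : ∃ a : ℤ → ℕ, Digits a ∧ cfSum a 0 = m ∧ ∀ i, cfSum a i ≤ m := by
  obtain ⟨a, X, Y, hX, hY, hXr, hYr, hle, heq⟩ := exists_markov_orbit hm h2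
  have hm' : m < 4.4722 := h20.trans (by rw [Real.sqrt_lt' (by norm_num)]; norm_num)
  have ha1 : ∀ i, 1 ≤ a i := fun i => by
    have h1 : (0 : ℝ) < a i := by nlinarith [hX i, hX (i + 1), hXr i]
    exact_mod_cast h1
  have ha4 : ∀ i, a i ≤ 4 := fun i => by
    have h1 : (a i : ℝ) < 5 := by linarith [hle i, hX (i + 1), hY i]
    have : a i < 5 := by exact_mod_cast h1
    omega
  have hlow : ∀ i, 1 / 5 ≤ X i ∧ 1 / 5 ≤ Y i := fun i => by
    have h1 : (a i : ℝ) ≤ 4 := by exact_mod_cast ha4 i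
    have h2 : (a (i - 1) : ℝ) ≤ 4 := by exact_mod_cast ha4 (i - 1)
    have h3 := hYr (i - 1)
    rw [sub_add_cancel] at h3
    exact ⟨by nlinarith [hX i, hX (i + 1), hXr i], by nlinarith [hY i, hY (i - 1)]⟩
  have hright : ∀ i, a i = 4 → a (i + 1) = 4 := by
    intro i hi
    by_contra hne
    have h3 : a (i + 1) ≤ 3 := by have := ha4 (i + 1); omega
    have h3' : (a (i + 1) : ℝ) ≤ 3 := by exact_mod_cast h3
    have hi' : (a i : ℝ) = 4 := by exact_mod_cast hi
    have hl := hle i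
    have hXi := hXr (i + 1)
    have hYi := hYr (i - 1)
    rw [sub_add_cancel] at hYi
    have hX1 : 1 / 4 < X (i + 1) := by nlinarith [hX (i + 1), hX (i + 1 + 1)]
    have hY1 : Y i < 0.2222 := by linarith
    have hb : (a (i - 1) : ℝ) + Y (i - 1) > 4.5 := by nlinarith [hY i, hY (i - 1)]
    have hb4 : (a (i - 1) : ℝ) ≤ 4 := by exact_mod_cast ha4 (i - 1)
    have hb3 : 4 ≤ a (i - 1) := by
      have : (3 : ℝ) < a (i - 1) := by linarith [hY (i - 1)]
      have : 3 < a (i - 1) := by exact_mod_cast this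
      omega
    have hl' := hle (i - 1)
    have hb3' : (4 : ℝ) ≤ a (i - 1) := by exact_mod_cast hb3
    linarith [hX (i - 1 + 1)]
  have hleft : ∀ i, a i = 4 → a (i - 1) = 4 := by
    intro i hi
    by_contra hne
    have h3 : a (i - 1) ≤ 3 := by have := ha4 (i - 1); omega
    have h3' : (a (i - 1) : ℝ) ≤ 3 := by exact_mod_cast h3
    have hi' : (a i : ℝ) = 4 := by exact_mod_cast hi
    have hl := hle i
    have hXi := hXr (i + 1)
    have hYi := hYr (i - 1)
    rw [sub_add_cancel] at hYi
    have hY1 : 1 / 4 < Y i := by nlinarith [hY i, hY (i - 1)]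
    have hX1 : X (i + 1) < 0.2222 := by linarith
    have hb : (a (i + 1) : ℝ) + X (i + 1 + 1) > 4.5 := by
      nlinarith [hX (i + 1), hX (i + 1 + 1)]
    have hb4 : (a (i + 1) : ℝ) ≤ 4 := by exact_mod_cast ha4 (i + 1)
    have hb3 : 4 ≤ a (i + 1) := by
      have : (3 : ℝ) < a (i + 1) := by linarith [hX (i + 1 + 1)]
      have : 3 < a (i + 1) := by exact_mod_cast this
      omega
    have hl' := hle (i + 1)
    have hb3' : (4 : ℝ) ≤ a (i + 1) := by exact_mod_cast hb3
    linarith [hY (i + 1)]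
  have ha3 : ∀ i, a i ≤ 3 := by
    intro i
    by_contra hi
    have hi4 : a i = 4 := by have := ha4 i; omega
    have hall : ∀ j, a j = 4 := by
      intro j
      induction j using Int.inductionOn' (b := i) with
      | zero => exact hi4
      | succ k _ hk => exact hright k hk
      | pred k _ hk => exact hleft k hk
    have hR : X (0 + 1 + (0 : ℕ)) = √5 - 2 := eq_of_recursion_four (Z := fun n => X (0 + 1 + n))
      (fun n => hX _) (fun n => by
        have := hXr (0 + 1 + n)
        rw [hall] at this
        push_cast at this ⊢
        rw [← add_assoc]
        exact this)
    have hL : Y (0 - (0 : ℕ)) = √5 - 2 := eq_of_recursion_four (Z := fun n => Y (0 - n))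
      (fun n => hY _) (fun n => by
        have := hYr (0 - n - 1)
        rw [hall, sub_add_cancel] at this
        push_cast at this ⊢
        rw [← sub_sub]
        exact this)
    rw [hall] at heq
    simp only [Nat.cast_zero, add_zero, sub_zero] at hR hL
    rw [hR, hL] at heq
    push_cast at heq
    have : √20 = 2 * √5 := by
      rw [show (20 : ℝ) = 2 ^ 2 * 5 by norm_num, Real.sqrt_mul (by norm_num),
        Real.sqrt_sq (by norm_num)]
    linarith
  have hcast : ∀ i, (((a i).toNat : ℕ) : ℝ) = a i := fun i => by
    have : (((a i).toNat : ℕ) : ℤ) = a i := Int.toNat_of_nonneg (by linarith [ha1 i])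
    exact_mod_cast this
  have hD : Digits (fun i => (a i).toNat) := fun i => by
    have := ha1 i
    have := ha3 i
    exact (by omega : 1 ≤ (a i).toNat ∧ (a i).toNat ≤ 3)
  have hXY : ∀ i, (1 / 4 ≤ X i ∧ X i ≤ 1) ∧ (1 / 4 ≤ Y i ∧ Y i ≤ 1) := fun i => by
    have h1 : (a i : ℝ) ≤ 3 := by exact_mod_cast ha3 i
    have h2 : (a (i - 1) : ℝ) ≤ 3 := by exact_mod_cast ha3 (i - 1)
    have h3 := hYr (i - 1)
    rw [sub_add_cancel] at h3
    exact ⟨⟨by nlinarith [hX i, hX (i + 1), hXr i], (hX i).2.le⟩,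
      ⟨by nlinarith [hY i, hY (i - 1)], (hY i).2.le⟩⟩
  have hval : ∀ i, cfSum (fun i => (a i).toNat) i = a i + X (i + 1) + Y i := by
    intro i
    have e1 : X (i + 1 + (0 : ℕ)) = _ := cfVal_unique (X := fun k => X (i + 1 + k))
      (hD.comp (fun k : ℕ => i + 1 + k)) (fun k => (hXY _).1) (fun k => by
        rw [eq_div_iff (by
          have := (hX (i + 1 + (k + 1 : ℕ))).1
          positivity), hcast]
        have := hXr (i + 1 + k)
        push_cast
        rw [← add_assoc]
        exact this)
    have e2 : Y (i - (0 : ℕ)) = _ := cfVal_unique (X := fun k => Y (i - k))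
      (hD.comp (fun k : ℕ => i - 1 - k)) (fun k => (hXY _).2) (fun k => by
        rw [eq_div_iff (by
          have := (hY (i - (k + 1 : ℕ))).1
          positivity), hcast]
        have := hYr (i - k - 1)
        rw [sub_add_cancel] at this
        push_cast
        rw [show i - 1 - (k : ℤ) = i - k - 1 by ring, ← sub_sub]
        exact this)
    simp only [Nat.cast_zero, add_zero, sub_zero] at e1 e2
    rw [cfSum, ← e1, ← e2, hcast]
  exact ⟨_, hD, by rw [hval]; exact heq, fun i => by rw [hval]; exact hle i⟩

theorem le_cfDen {γ : ℕ → ℕ} (h : Digits γ) (n : ℕ) : n ≤ (cfDen γ n).1 := by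
  induction n with
  | zero => simp
  | succ n ih =>
    rcases n.eq_zero_or_pos with rfl | hn
    · exact cfDen_pos h 1
    · have h1 : 0 < (cfDen γ n).2 := by
        obtain ⟨k, rfl⟩ := Nat.exists_eq_add_of_le' hn
        exact cfDen_pos h k
      have := Nat.mul_le_mul_right (cfDen γ n).1 (h n).1
      simp only [cfDen]
      omega

theorem cfDen_le_succ {γ : ℕ → ℕ} (h : Digits γ) (n : ℕ) :
    (cfDen γ n).1 ≤ (cfDen γ (n + 1)).1 := cfDen_snd_le h (n + 1)

theorem cfDen_mono {γ : ℕ → ℕ} (h : Digits γ) : Monotone fun n => (cfDen γ n).1 :=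
  monotone_nat_of_le_succ (cfDen_le_succ h)

theorem cfNum_succ (γ : ℕ → ℕ) (n : ℕ) :
    cfNum γ (n + 1) = cfDen (fun k => γ (k + 1)) n := by
  induction n with
  | zero => simp [cfNum, cfDen]
  | succ n ih => rw [cfNum, ih, cfDen]

/-- The distance `|q n * α - p n|` for the value `α` of the continued fraction, in terms of the
complete quotients. -/
theorem cfDen_mul_abs_sub {γ : ℕ → ℕ} (h : Digits γ) (n : ℕ) :
    (cfDen γ n).1 * |(cfDen γ n).1 * cfVal γ - (cfNum γ n).1| *
      (γ n + cfVal (fun k => γ (k + (n + 1))) + (cfDen γ n).2 / (cfDen γ n).1) = 1 := by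
  have h1 := cfVal_eq_mobius h n
  have hx := cfVal_shift h n
  have hp := cfVal_pos (h.comp (fun k => k + (n + 1)))
  have hx0 := cfVal_pos (h.comp (fun k => k + n))
  have hg := h.one_le n
  have hdet : ((cfNum γ n).1 : ℝ) * (cfDen γ n).2 - (cfNum γ n).2 * (cfDen γ n).1
      = (-1) ^ (n + 1) := by exact_mod_cast cf_det γ n
  have hq : (0 : ℝ) < (cfDen γ n).1 := by exact_mod_cast cfDen_pos h n
  have hq' : (0 : ℝ) ≤ (cfDen γ n).2 := by positivity
  have hy : (γ n : ℝ) + cfVal (fun k => γ (k + (n + 1))) = 1 / cfVal (fun k => γ (k + n)) := by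
    rw [hx, one_div_one_div]
  rw [hy]
  set x := cfVal (fun k => γ (k + n))
  set q := ((cfDen γ n).1 : ℝ)
  set q' := ((cfDen γ n).2 : ℝ)
  set p := ((cfNum γ n).1 : ℝ)
  set p' := ((cfNum γ n).2 : ℝ)
  have h0 : 0 < q + q' * x := by positivity
  have e : (q * cfVal γ - p) * (q + q' * x) = -((-1) ^ (n + 1)) * x := by
    rw [← hdet]; linear_combination q * h1
  have e' : |q * cfVal γ - p| * (q + q' * x) = x := by
    have := congrArg abs e
    rwa [abs_mul, abs_of_pos h0, abs_mul, abs_neg, abs_pow, abs_neg, abs_one, one_pow, one_mul,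
      abs_of_pos hx0] at this
  calc q * |q * cfVal γ - p| * (1 / x + q' / q)
      = |q * cfVal γ - p| * (q + q' * x) / x := by field_simp
    _ = 1 := by rw [e', div_self hx0.ne']

theorem abs_cfDen_mul_sub_pos {γ : ℕ → ℕ} (h : Digits γ) (n : ℕ) :
    0 < |(cfDen γ n).1 * cfVal γ - (cfNum γ n).1| := by
  refine (abs_nonneg _).lt_of_ne fun h0 => ?_
  have := cfDen_mul_abs_sub h n
  rw [← h0] at this
  simp at this

/-- The truncations of a continued fraction are best approximations. -/
theorem abs_cfDen_mul_sub_le {γ : ℕ → ℕ} (h : Digits γ) {n : ℕ} {P Q : ℤ} (hQ : 0 < Q)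
    (hlt : Q < (cfDen γ (n + 1)).1) :
    |(cfDen γ n).1 * cfVal γ - (cfNum γ n).1| ≤ |Q * cfVal γ - P| := by
  have h1 := cfVal_eq_mobius h (n + 1)
  have hx := cfVal_mem (h.comp (fun k => k + (n + 1)))
  have hdet := cf_det γ (n + 1)
  have hq := cfDen_pos h n
  have e2 : (cfDen γ (n + 1)).2 = (cfDen γ n).1 := rfl
  have e3 : (cfNum γ (n + 1)).2 = (cfNum γ n).1 := rfl
  rw [e2, e3] at hdet h1
  generalize (cfDen γ (n + 1)).1 = Q₁ at *
  generalize (cfNum γ (n + 1)).1 = P₁ at *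
  generalize (cfDen γ n).1 = Q₀ at *
  generalize (cfNum γ n).1 = P₀ at *
  generalize cfVal (fun k => γ (k + (n + 1))) = x at *
  set e : ℤ := (-1) ^ (n + 1 + 1) with he
  have hee : e * e = 1 := by rw [he, ← mul_pow]; norm_num
  set v : ℤ := e * (P * Q₀ - Q * P₀) with hv
  set u : ℤ := e * (Q * P₁ - P * Q₁) with hu
  have hQuv : Q = u * Q₀ + v * Q₁ := by
    rw [hv, hu]; linear_combination (-Q) * hee - Q * e * hdet
  have hPuv : P = u * P₀ + v * P₁ := by
    rw [hv, hu]; linear_combination (-P) * hee - P * e * hdet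
  have key : (Q : ℝ) * cfVal γ - P = (u - v * x) * (Q₀ * cfVal γ - P₀) := by
    rw [hQuv, hPuv]
    push_cast
    linear_combination (v : ℝ) * h1
  rw [key, abs_mul]
  refine le_mul_of_one_le_left (abs_nonneg _) ?_
  have hQ₀ : (0 : ℤ) < Q₀ := by exact_mod_cast hq
  have hx0 : (0 : ℝ) ≤ x := by linarith
  rcases lt_trichotomy v 0 with hv0 | hv0 | hv0
  · have h3 : 0 < u := by
      by_contra! hu0
      nlinarith
    have h4 : (1 : ℝ) ≤ u := by exact_mod_cast h3
    have h5 : (v : ℝ) ≤ 0 := by exact_mod_cast hv0.le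
    refine le_trans ?_ (le_abs_self _)
    nlinarith
  · have h3 : 0 < u := by
      by_contra! hu0
      rw [hv0] at hQuv
      nlinarith
    have h4 : (1 : ℝ) ≤ u := by exact_mod_cast h3
    rw [hv0]
    refine le_trans ?_ (le_abs_self _)
    simpa using h4
  · have h3 : u < 0 := by
      by_contra! hu0
      nlinarith
    have h4 : (u : ℝ) ≤ -1 := by exact_mod_cast (by omega : u ≤ -1)
    have h5 : (0 : ℝ) ≤ v := by exact_mod_cast hv0.le
    refine le_trans ?_ (neg_le_abs _)
    nlinarith

theorem irrational_cfVal {γ : ℕ → ℕ} (h : Digits γ) : Irrational (cfVal γ) := by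
  rintro ⟨r, hr⟩
  have hlt : (r.den : ℤ) < (cfDen γ (r.den + 1)).1 := by
    exact_mod_cast le_cfDen h (r.den + 1)
  have h1 := abs_cfDen_mul_sub_le h (P := r.num) (by exact_mod_cast r.den_pos) hlt
  have h2 := abs_cfDen_mul_sub_pos h r.den
  have h3 : ((r.den : ℤ) : ℝ) * cfVal γ - r.num = 0 := by
    rw [← hr, sub_eq_zero]
    exact_mod_cast r.den_mul_eq_num
  rw [h3, abs_zero] at h1
  linarith

/-- The quotients of consecutive denominators approximate the continued fractions of the reversed
sequences. -/
theorem abs_cfDen_div_sub_le {b : ℤ → ℕ} (hb : Digits b) (n : ℕ) :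
    |((cfDen (fun k : ℕ => b k) (n + 1)).2 : ℝ) / (cfDen (fun k : ℕ => b k) (n + 1)).1 -
      cfVal (fun k : ℕ => b ((n + 1 : ℕ) - 1 - k))| ≤ (16 / 25) ^ n := by
  have hγ : Digits (fun k : ℕ => b k) := hb.comp _
  have hz : ∀ n, ((cfDen (fun k : ℕ => b k) (n + 1)).2 : ℝ) / (cfDen (fun k : ℕ => b k) (n + 1)).1
      = 1 / (b n + ((cfDen (fun k : ℕ => b k) n).2 : ℝ) / (cfDen (fun k : ℕ => b k) n).1) := by
    intro n
    have hq : (0 : ℝ) < (cfDen (fun k : ℕ => b k) n).1 := by exact_mod_cast cfDen_pos hγ n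
    simp only [cfDen]
    push_cast
    field_simp
  have hz1 : ∀ n, 1 / 4 ≤ ((cfDen (fun k : ℕ => b k) (n + 1)).2 : ℝ) /
      (cfDen (fun k : ℕ => b k) (n + 1)).1 ∧ ((cfDen (fun k : ℕ => b k) (n + 1)).2 : ℝ) /
      (cfDen (fun k : ℕ => b k) (n + 1)).1 ≤ 1 := by
    intro n
    have hq : (0 : ℝ) < (cfDen (fun k : ℕ => b k) (n + 1)).1 := by
      exact_mod_cast cfDen_pos hγ (n + 1)
    constructor
    · rw [div_le_div_iff₀ (by norm_num) hq, one_mul, mul_comm]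
      exact_mod_cast cfDen_fst_le hγ n
    · rw [div_le_one hq]
      exact_mod_cast cfDen_snd_le hγ (n + 1)
  have hy : ∀ n : ℕ, Digits (fun k : ℕ => b (n - 1 - k)) := fun n => hb.comp _
  induction n with
  | zero =>
    have aux : ∀ x y : ℝ, (1 / 4 ≤ x ∧ x ≤ 1) → (1 / 4 ≤ y ∧ y ≤ 1) → |x - y| ≤ 1 :=
      fun x y hx hy => abs_le.2 ⟨by linarith, by linarith⟩
    rw [pow_zero]
    exact aux _ _ (hz1 0) (cfVal_mem_one (hy (0 + 1)))
  | succ n ih =>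
    have e : cfVal (fun k : ℕ => b ((n + 1 + 1 : ℕ) - 1 - k)) =
        1 / (b (n + 1 : ℕ) + cfVal (fun k : ℕ => b ((n + 1 : ℕ) - 1 - k))) := by
      rw [cfVal_eq (hy (n + 1 + 1))]
      congr 3
      · congr 1; push_cast; ring
      · funext k
        congr 1
        push_cast
        ring
    rw [hz (n + 1), e, pow_succ']
    refine (inv_add_sub_le (hb.one_le _) (hz1 n).1 (cfVal_mem (hy (n + 1))).1).trans ?_
    gcongr

theorem tendsto_cofinite_of_le {f : ℕ → ℕ} (h : ∀ n, n ≤ f n) :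
    Tendsto (fun n => (f n : ℤ)) atTop cofinite := by
  rw [Int.cofinite_eq]
  refine Tendsto.mono_right ?_ le_sup_right
  exact tendsto_natCast_atTop_atTop.comp (tendsto_atTop_mono h tendsto_id)

/-- The upper limit of the values of a two-sided sequence at the positive positions belongs to the
Lagrange spectrum. -/
theorem mem_lagrangeSpectrum_of_cfSum {b : ℤ → ℕ} (hb : Digits b) {m : ℝ}
    (hle : ∀ ε > 0, ∀ᶠ n : ℕ in atTop, cfSum b n ≤ m + ε)
    (hge : ∀ ε > 0, ∃ᶠ n : ℕ in atTop, m - ε ≤ cfSum b n) : m ∈ lagrangeSpectrum := by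
  set γ : ℕ → ℕ := fun k => b k with hγdef
  have hγ : Digits γ := hb.comp _
  set Λ : ℕ → ℝ := fun n =>
    γ n + cfVal (fun k => γ (k + (n + 1))) + (cfDen γ n).2 / (cfDen γ n).1 with hΛ
  have hΛpos : ∀ n, 0 < Λ n := fun n => by
    have := hγ.one_le n
    have := cfVal_pos (hγ.comp (fun k => k + (n + 1)))
    simp only [hΛ]
    positivity
  have hΛ1 : ∀ n, (cfDen γ n).1 * |(cfDen γ n).1 * cfVal γ - (cfNum γ n).1| = 1 / Λ n := fun n => by
    rw [eq_div_iff (hΛpos n).ne']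
    exact cfDen_mul_abs_sub hγ n
  have hclose : ∀ n : ℕ, |Λ (n + 1) - cfSum b (n + 1 : ℕ)| ≤ (16 / 25) ^ n := by
    intro n
    refine le_trans (le_of_eq ?_) (abs_cfDen_div_sub_le hb n)
    congr 1
    have e : (fun k => γ (k + (n + 1 + 1))) = fun k : ℕ => b ((n + 1 : ℕ) + 1 + k) := by
      funext k
      simp only [hγdef]
      congr 1
      push_cast
      ring
    simp only [hΛ, cfSum, e]
    ring
  have hsmall : ∀ ε > 0, ∀ᶠ n : ℕ in atTop, |Λ n - cfSum b n| ≤ ε := by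
    intro ε hε
    have h1 : ∀ᶠ n : ℕ in atTop, ((16 / 25 : ℝ)) ^ n ≤ ε :=
      (tendsto_pow_atTop_nhds_zero_of_lt_one (by norm_num) (by norm_num)).eventually_le_const hε
    have h2 : ∀ᶠ n : ℕ in atTop, |Λ (n + 1) - cfSum b (n + 1 : ℕ)| ≤ ε :=
      h1.mono fun n hn => (hclose n).trans hn
    exact (eventually_atTop.2 (by
      obtain ⟨N, hN⟩ := eventually_atTop.1 h2
      refine ⟨N + 1, fun n hn => ?_⟩
      obtain ⟨k, rfl⟩ := Nat.exists_eq_add_of_le' (show 1 ≤ n by omega)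
      exact hN k (by omega)))
  refine ⟨cfVal γ, irrational_cfVal hγ, le_antisymm ?_ ?_⟩
  · refine (EReal.le_of_forall_lt_iff_le).1 fun z hz => ?_
    have hz' : m < z := by exact_mod_cast hz
    refine limsup_le_of_le (by isBoundedDefault) ?_
    obtain ⟨N, hN⟩ := eventually_atTop.1 ((hle ((z - m) / 2) (by linarith)).and
      (hsmall ((z - m) / 2) (by linarith)))
    have hΛz : ∀ n ≥ N, Λ n ≤ z := fun n hn => by
      have := hN n hn
      have := (abs_le.1 this.2).2
      linarith
    have hz0 : 0 < z := (hΛpos N).trans_le (hΛz N le_rfl)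
    have pos : ∀ P Q : ℤ, 0 < Q → (cfDen γ N).1 ≤ Q →
        1 / |(Q : ℝ) * ((Q : ℝ) * cfVal γ - (P : ℝ))| ≤ z := by
      intro P Q hQ hNQ
      classical
      have hex : ∃ n, Q < (cfDen γ (n + 1)).1 :=
        ⟨Q.toNat, by have := le_cfDen hγ (Q.toNat + 1); omega⟩
      obtain ⟨n, hn, hmin⟩ : ∃ n, Q < (cfDen γ (n + 1)).1 ∧ (cfDen γ n).1 ≤ Q := by
        refine ⟨Nat.find hex, Nat.find_spec hex, ?_⟩
        rcases hn : Nat.find hex with _ | k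
        · exact Int.add_one_le_of_lt hQ
        · exact not_lt.1 (Nat.find_min hex (m := k) (by omega))
      have hNn : N ≤ n := by
        by_contra! hlt
        have : (cfDen γ (n + 1)).1 ≤ (cfDen γ N).1 := cfDen_mono hγ hlt
        omega
      have h1 := abs_cfDen_mul_sub_le hγ (P := P) hQ hn
      have hmin' : ((cfDen γ n).1 : ℝ) ≤ Q := by exact_mod_cast hmin
      have hQ' : (0 : ℝ) < Q := by exact_mod_cast hQ
      have h2 : 1 / z ≤ |(Q : ℝ) * ((Q : ℝ) * cfVal γ - (P : ℝ))| := by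
        rw [abs_mul, abs_of_pos hQ']
        calc 1 / z ≤ 1 / Λ n := one_div_le_one_div_of_le (hΛpos n) (hΛz n hNn)
          _ = _ := (hΛ1 n).symm
          _ ≤ _ := mul_le_mul hmin' h1 (abs_nonneg _) hQ'.le
      have h3 : 0 < |(Q : ℝ) * ((Q : ℝ) * cfVal γ - (P : ℝ))| := lt_of_lt_of_le (by positivity) h2
      rw [div_le_iff₀ h3]
      rw [div_le_iff₀ hz0] at h2
      linarith
    have hcof : ∀ᶠ Q : ℤ in cofinite, ((cfDen γ N).1 : ℤ) ≤ |Q| := by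
      refine Set.Finite.subset (Set.finite_Ioo (-((cfDen γ N).1 : ℤ)) (cfDen γ N).1) ?_
      intro Q hQ
      have : ¬ ((cfDen γ N).1 : ℤ) ≤ |Q| := hQ
      exact abs_lt.1 (not_le.1 this)
    refine (hcof.prod_inr cofinite).mono ?_
    rintro ⟨P, Q⟩ hQ
    simp only at hQ ⊢
    have hpos : (0 : ℤ) < (cfDen γ N).1 := by exact_mod_cast cfDen_pos hγ N
    refine EReal.coe_le_coe_iff.2 ?_
    rcases abs_cases Q with ⟨h, h0⟩ | ⟨h, h0⟩
    · exact pos P Q (by omega) (by omega)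
    · have := pos (-P) (-Q) (by omega) (by omega)
      refine le_trans (le_of_eq ?_) this
      congr 2
      push_cast
      ring
  · refine (EReal.ge_of_forall_gt_iff_ge).1 fun z hz => ?_
    have hz' : z < m := by exact_mod_cast hz
    refine le_limsup_of_frequently_le ?_ (by isBoundedDefault)
    have hf : ∃ᶠ n : ℕ in atTop, z ≤ Λ n :=
      ((hge ((m - z) / 2) (by linarith)).and_eventually
        (hsmall ((m - z) / 2) (by linarith))).mono fun n hn => by
          have := (abs_le.1 hn.2).1
          linarith
    have ht : Tendsto (fun n => (((cfNum γ (n + 1)).1 : ℤ), ((cfDen γ (n + 1)).1 : ℤ))) atTop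
        ((cofinite : Filter ℤ) ×ˢ (cofinite : Filter ℤ)) := by
      refine Tendsto.prodMk (tendsto_cofinite_of_le fun n => ?_) (tendsto_cofinite_of_le fun n => ?_)
      · rw [cfNum_succ]
        exact le_cfDen (hγ.comp _) n
      · exact (Nat.le_succ n).trans (le_cfDen hγ (n + 1))
    refine ht.frequently ?_
    have hf' : ∃ᶠ n : ℕ in atTop, z ≤ Λ (n + 1) := by
      rw [frequently_atTop] at hf ⊢
      intro a
      obtain ⟨n, hn, hz⟩ := hf (a + 1)
      obtain ⟨k, rfl⟩ := Nat.exists_eq_add_of_le' (show 1 ≤ n by omega)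
      exact ⟨k, by omega, hz⟩
    refine hf'.mono fun n hn => EReal.coe_le_coe_iff.2 (hn.trans (le_of_eq ?_))
    have h1 := hΛ1 (n + 1)
    have hq : (0 : ℝ) < (cfDen γ (n + 1)).1 := by exact_mod_cast cfDen_pos hγ (n + 1)
    simp only [Int.cast_natCast]
    rw [abs_mul, abs_of_pos hq, h1, one_div_one_div]

theorem cfSum_dist {a b : ℤ → ℕ} (ha : Digits a) (hb : Digits b) {i : ℤ} {N : ℕ}
    (h : ∀ j, i - N ≤ j → j ≤ i + N → a j = b j) :
    |cfSum a i - cfSum b i| ≤ 2 * (16 / 25) ^ N := by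
  have h1 := cfVal_dist (ha.comp (fun k : ℕ => i + 1 + k)) (hb.comp (fun k : ℕ => i + 1 + k))
    (n := N) (fun k hk => h _ (by omega) (by omega))
  have h2 := cfVal_dist (ha.comp (fun k : ℕ => i - 1 - k)) (hb.comp (fun k : ℕ => i - 1 - k))
    (n := N) (fun k hk => h _ (by omega) (by omega))
  rw [cfSum, cfSum, h i (by omega) (by omega)]
  rw [abs_le] at *
  constructor <;> linarith

theorem cfSum_comp_neg (a : ℤ → ℕ) (i : ℤ) : cfSum (fun j => a (-j)) i = cfSum a (-i) := by
  have e1 : (fun k : ℕ => a (-(i + 1 + k))) = fun k : ℕ => a (-i - 1 - k) := by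
    funext k; congr 1; ring
  have e2 : (fun k : ℕ => a (-(i - 1 - k))) = fun k : ℕ => a (-i + 1 + k) := by
    funext k; congr 1; ring
  rw [cfSum, cfSum, e1, e2]
  ring

theorem cfSum_shift (a : ℤ → ℕ) (t i : ℤ) : cfSum (fun j => a (j - t)) i = cfSum a (i - t) := by
  have e1 : (fun k : ℕ => a (i + 1 + k - t)) = fun k : ℕ => a (i - t + 1 + k) := by
    funext k; congr 1; ring
  have e2 : (fun k : ℕ => a (i - 1 - k - t)) = fun k : ℕ => a (i - t - 1 - k) := by
    funext k; congr 1; ring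
  rw [cfSum, cfSum, e1, e2]

theorem cfSum_le_of_digit_le_two {a : ℤ → ℕ} (ha : Digits a) {i : ℤ} (h : a i ≤ 2) :
    cfSum a i ≤ 3.6 := by
  have h1 := cfVal_mem (ha.comp (fun k : ℕ => i + 1 + k))
  have h2 := cfVal_mem (ha.comp (fun k : ℕ => i - 1 - k))
  have h3 : (a i : ℝ) ≤ 2 := by exact_mod_cast h
  rw [cfSum]
  linarith

theorem exists_pow_le {ε : ℝ} (hε : 0 < ε) (C : ℝ) :
    ∃ N : ℕ, ∀ n ≥ N, C * (16 / 25 : ℝ) ^ n ≤ ε := by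
  have h : Tendsto (fun n : ℕ => C * (16 / 25 : ℝ) ^ n) atTop (𝓝 (C * 0)) :=
    (tendsto_pow_atTop_nhds_zero_of_lt_one (by norm_num) (by norm_num)).const_mul C
  rw [mul_zero] at h
  exact eventually_atTop.1 (h.eventually_le_const hε)

/-- Beyond every position the sequence can be continued by a sequence of digits that is eventually
constant `1`, without raising the supremum of the values by more than `ε`. -/
def RightConnectable (a : ℤ → ℕ) (m ε : ℝ) (N : ℕ) : Prop :=
  ∃ n : ℤ, N ≤ n ∧ ∃ c : ℤ → ℕ, Digits c ∧ (∀ i ≤ n, c i = a i) ∧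
    (∃ R : ℤ, ∀ i, R < i → c i = 1) ∧ ∀ i, cfSum c i ≤ m + ε

theorem RightConnectable.mono {a : ℤ → ℕ} {m ε ε' : ℝ} {N N' : ℕ}
    (h : RightConnectable a m ε' N') (hε : ε' ≤ ε) (hN : N ≤ N') : RightConnectable a m ε N := by
  obtain ⟨n, hn, c, h1, h2, h3, h4⟩ := h
  exact ⟨n, by omega, c, h1, h2, h3, fun i => (h4 i).trans (by gcongr)⟩

/-- Two one-sided modifications of a sequence are combined into a two-sided one. -/
theorem exists_two_sided {a : ℤ → ℕ} {m : ℝ} (ha : Digits a) (h0 : cfSum a 0 = m)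
    (hr : ∀ ε > 0, ∀ N, RightConnectable a m ε N)
    (hl : ∀ ε > 0, ∀ N, RightConnectable (fun i => a (-i)) m ε N) {ε : ℝ} (hε : 0 < ε) :
    ∃ c : ℤ → ℕ, Digits c ∧ (∃ R : ℕ, ∀ i : ℤ, R < |i| → c i = 1) ∧
      (∀ i, cfSum c i ≤ m + ε) ∧ m - ε ≤ cfSum c 0 := by
  obtain ⟨N, hN⟩ := exists_pow_le (half_pos hε) 2
  have hN := hN N le_rfl
  obtain ⟨n, hn, c, hc, hca, ⟨R, hR⟩, hcm⟩ := hr (ε / 2) (half_pos hε) N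
  obtain ⟨n', hn', d, hd, hda, ⟨R', hR'⟩, hdm⟩ := hl (ε / 2) (half_pos hε) N
  have hd' : Digits (fun i => d (-i)) := hd.comp _
  have hda' : ∀ i : ℤ, -n' ≤ i → d (-i) = a i := fun i hi => by
    simpa using hda (-i) (by omega)
  set e : ℤ → ℕ := fun i => if 0 ≤ i then c i else d (-i) with he
  have hec : ∀ i : ℤ, -N ≤ i → e i = c i := by
    intro i hi
    by_cases h : 0 ≤ i
    · simp [he, h]
    · simp only [he, h, if_false]
      rw [hda' i (by omega), hca i (by omega)]
  have hed : ∀ i : ℤ, i ≤ N → e i = d (-i) := by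
    intro i hi
    by_cases h : 0 ≤ i
    · simp only [he, h, if_true]
      rw [hda' i (by omega), hca i (by omega)]
    · simp [he, h]
  have hD : Digits e := fun i => by
    by_cases h : 0 ≤ i
    · simp only [he, h, if_true]; exact hc i
    · simp only [he, h, if_false]; exact hd (-i)
  refine ⟨e, hD, ⟨(max R R').toNat, fun i hi => ?_⟩, fun i => ?_, ?_⟩
  · by_cases h : 0 ≤ i
    · simp only [he, h, if_true]
      rw [abs_of_nonneg h] at hi
      exact hR i (by omega)
    · simp only [he, h, if_false]
      rw [abs_of_neg (by omega)] at hi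
      exact hR' (-i) (by omega)
  · by_cases h : 0 ≤ i
    · have := cfSum_dist hD hc (i := i) (N := N) fun j hj _ => hec j (by omega)
      have := (abs_le.1 this).2
      linarith [hcm i]
    · have := cfSum_dist hD hd' (i := i) (N := N) fun j _ hj => hed j (by omega)
      have := (abs_le.1 this).2
      have h1 := hdm (-i)
      rw [cfSum_comp_neg] at this
      linarith
  · have := cfSum_dist hD ha (i := 0) (N := N) fun j hj hj' => by
      rw [hec j (by omega), hca j (by omega)]
    have := (abs_le.1 this).1
    linarith

/-- The limit superior of the values of suitably concatenated sequences. -/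
theorem mem_lagrangeSpectrum_of_two_sided {m : ℝ}
    (h : ∀ ε > 0, ∃ c : ℤ → ℕ, Digits c ∧ (∃ R : ℕ, ∀ i : ℤ, R < |i| → c i = 1) ∧
      (∀ i, cfSum c i ≤ m + ε) ∧ m - ε ≤ cfSum c 0) : m ∈ lagrangeSpectrum := by
  classical
  choose c hc hR hle hge using fun k : ℕ => h (1 / ((k : ℝ) + 1)) (by positivity)
  choose R hR using hR
  obtain ⟨t, ht⟩ : ∃ t : ℕ → ℕ, ∀ k, t (k + 1) = t k + R k + R (k + 1) + 2 * (k + 1) + 1 :=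
    ⟨fun k => Nat.rec 0 (fun k t => t + R k + R (k + 1) + 2 * (k + 1) + 1) k, fun k => rfl⟩
  have hs : Monotone fun k => t k + R k := monotone_nat_of_le_succ fun k => by
    rw [ht]; omega
  have hgap : ∀ k' k, k' < k → t k' + R k' + R k + 2 * k + 1 ≤ t k := by
    intro k' k hk
    obtain ⟨j, rfl⟩ := Nat.exists_eq_add_of_le' (show 1 ≤ k by omega)
    have : t k' + R k' ≤ t j + R j := hs (show k' ≤ j by omega)
    rw [ht]
    omega
  set b : ℤ → ℕ := fun i =>
    if h : ∃ k, |i - t k| ≤ R k then c h.choose (i - t h.choose) else 1 with hb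
  have hbD : Digits b := fun i => by
    by_cases h : ∃ k, |i - t k| ≤ R k
    · simp only [hb, h, dif_pos]; exact hc _ _
    · simp only [hb, h, dif_neg, not_false_iff]; omega
  have hwin : ∀ (i : ℤ) (K k : ℕ),
      (∀ k' j, i - K ≤ j → j ≤ i + K → |j - t k'| ≤ R k' → k' = k) →
      |cfSum b i - cfSum (c k) (i - t k)| ≤ 2 * (16 / 25) ^ K := by
    intro i K k huniq
    rw [← cfSum_shift]
    refine cfSum_dist hbD ((hc k).comp _) fun j hj hj' => ?_
    by_cases h : ∃ k, |j - t k| ≤ R k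
    · have := huniq _ j hj hj' h.choose_spec
      simp only [hb, h, dif_pos]
      rw [this]
    · simp only [hb, h, dif_neg, not_false_iff]
      push Not at h
      exact (hR k _ (h k)).symm
  have hone : ∀ (i : ℤ) (K k k' : ℕ) (j j' : ℤ), K ≤ k → i - K ≤ j → j ≤ i + K → i - K ≤ j' →
      j' ≤ i + K → |j - t k| ≤ R k → |j' - t k'| ≤ R k' → k' ≤ k := by
    intro i K k k' j j' hK h1 h2 h3 h4 h5 h6
    by_contra! hlt
    have := hgap k k' hlt
    rw [abs_le] at h5 h6
    omega
  have hsmall : ∀ ε > 0, ∃ K₀ : ℕ, ∀ K ≥ K₀, 1 / ((K : ℝ) + 1) + 2 * (16 / 25) ^ K ≤ ε := by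
    intro ε hε
    obtain ⟨N₁, hN₁⟩ := exists_pow_le (half_pos hε) 2
    obtain ⟨N₂, hN₂⟩ := exists_nat_one_div_lt (half_pos hε)
    refine ⟨max N₁ N₂, fun K hK => ?_⟩
    have h1 := hN₁ K ((le_max_left _ _).trans hK)
    have h2 : 1 / ((K : ℝ) + 1) ≤ 1 / ((N₂ : ℝ) + 1) :=
      one_div_le_one_div_of_le (by positivity) (by
        have : (N₂ : ℝ) ≤ K := by exact_mod_cast (le_max_right _ _).trans hK
        linarith)
    linarith
  refine mem_lagrangeSpectrum_of_cfSum hbD (fun ε hε => ?_) (fun ε hε => ?_)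
  · obtain ⟨K, hK⟩ := hsmall ε hε
    have hK' := hK K le_rfl
    refine eventually_atTop.2 ⟨t K + R K + K + 1, fun i hi => ?_⟩
    have hbig : ∀ k' (j : ℤ), (i : ℤ) - K ≤ j → |j - t k'| ≤ R k' → K ≤ k' := by
      intro k' j hj h
      by_contra! hlt
      have : t k' + R k' ≤ t K + R K := hs hlt.le
      rw [abs_le] at h
      omega
    obtain ⟨k, hk, huniq⟩ : ∃ k, K ≤ k ∧
        ∀ k' j, (i : ℤ) - K ≤ j → j ≤ (i : ℤ) + K → |j - t k'| ≤ R k' → k' = k := by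
      by_cases hex : ∃ k, ∃ j, (i : ℤ) - K ≤ j ∧ j ≤ (i : ℤ) + K ∧ |j - t k| ≤ R k
      · obtain ⟨k, j, h1, h2, h3⟩ := hex
        exact ⟨k, hbig k j h1 h3, fun k' j' h1' h2' h3' => le_antisymm
          (hone i K k k' j j' (hbig k j h1 h3) h1 h2 h1' h2' h3 h3')
          (hone i K k' k j' j (hbig k' j' h1' h3') h1' h2' h1 h2 h3' h3)⟩
      · exact ⟨K, le_rfl, fun k' j h1 h2 h3 => absurd ⟨k', j, h1, h2, h3⟩ hex⟩
    have h1 := (abs_le.1 (hwin i K k huniq)).2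
    have h2 := hle k (i - t k)
    have h3 : 1 / ((k : ℝ) + 1) ≤ 1 / ((K : ℝ) + 1) :=
      one_div_le_one_div_of_le (by positivity) (by
        have : (K : ℝ) ≤ k := by exact_mod_cast hk
        linarith)
    linarith
  · obtain ⟨K₀, hK₀⟩ := hsmall ε hε
    refine frequently_atTop.2 fun A => ?_
    set k := max K₀ A with hk
    have htk : k ≤ t k := by
      rcases k.eq_zero_or_pos with h | h
      · omega
      · have := hgap 0 k h
        omega
    refine ⟨t k, (le_max_right _ _).trans htk, ?_⟩
    have huniq : ∀ k' j, (t k : ℤ) - k ≤ j → j ≤ (t k : ℤ) + k → |j - t k'| ≤ R k' → k' = k := by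
      intro k' j h1 h2 h3
      have h0 : |(t k : ℤ) - t k| ≤ R k := by simp
      have h4 : k' ≤ k := hone (t k) k k k' (t k) j le_rfl (by omega) (by omega) h1 h2 h0 h3
      refine le_antisymm h4 ?_
      by_contra! hlt
      have := hgap k' k hlt
      rw [abs_le] at h3
      omega
    have h1 := (abs_le.1 (hwin (t k) k k huniq)).1
    have h2 := hge k
    have h3 := hK₀ k (le_max_left _ _)
    rw [sub_self] at h1
    linarith

/-- The sequence that follows `a` up to the position `n` and continues with `w`. -/
def splice (a : ℤ → ℕ) (n : ℤ) (w : ℕ → ℕ) : ℤ → ℕ :=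
  fun i => if i ≤ n then a i else w (i - n - 1).toNat

theorem splice_of_le {a : ℤ → ℕ} {n : ℤ} {w : ℕ → ℕ} {i : ℤ} (h : i ≤ n) :
    splice a n w i = a i := if_pos h

theorem splice_add (a : ℤ → ℕ) (n : ℤ) (w : ℕ → ℕ) (k : ℕ) : splice a n w (n + 1 + k) = w k := by
  rw [splice, if_neg (by omega)]
  congr 1
  omega

theorem Digits.splice {a : ℤ → ℕ} {w : ℕ → ℕ} (ha : Digits a) (hw : Digits w) (n : ℤ) :
    Digits (splice a n w) := fun i => by
  by_cases h : i ≤ n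
  · rw [splice_of_le h]; exact ha i
  · rw [_root_.splice, if_neg h]; exact hw _

/-- If two sequences with almost the same supremum of values agree up to the position `n` and a
tail between their tails has small values, then the sequences connect to that tail. -/
theorem rightConnectable_of_between {a a' : ℤ → ℕ} {m m' ε : ℝ} {N : ℕ} {n : ℤ} {w : ℕ → ℕ}
    (ha : Digits a) (ha' : Digits a') (hm : ∀ i, cfSum a i ≤ m) (hm' : ∀ i, cfSum a' i ≤ m')
    (hmm : m' ≤ m + ε / 4) (hε : 2 * (16 / 25 : ℝ) ^ N ≤ ε / 4) (h384 : 3.84 ≤ m) (hn : N ≤ n)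
    (hagree : ∀ i, -(N : ℤ) ≤ i → i ≤ n → a i = a' i) (hw : Digits w) {R : ℕ}
    (hR : ∀ k, R ≤ k → w k = 1)
    (hbetween : cfVal w ∈ Set.uIcc (cfVal fun k : ℕ => a (n + 1 + k))
      (cfVal fun k : ℕ => a' (n + 1 + k)))
    (hsmall : ∀ k : ℕ, cfSum (splice a n w) (n + 1 + k) ≤ 3.84) : RightConnectable a m ε N := by
  have hc := ha.splice hw n
  have hpow : 0 < (16 / 25 : ℝ) ^ N := by positivity
  refine ⟨n, hn, splice a n w, hc, fun i hi => splice_of_le hi, ⟨n + R, fun i hi => ?_⟩,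
    fun i => ?_⟩
  · rw [splice, if_neg (by omega)]
    exact hR _ (by omega)
  rcases lt_or_ge n i with hi | hi
  · have := hsmall (i - n - 1).toNat
    rw [show n + 1 + ((i - n - 1).toNat : ℤ) = i by omega] at this
    linarith
  rcases lt_or_ge i 0 with hi0 | hi0
  · have := cfSum_dist hc ha (i := i) (N := N) fun j _ hj => splice_of_le (by omega)
    have := (abs_le.1 this).2
    linarith [hm i]
  · obtain ⟨l, hl⟩ : ∃ l : ℕ, n = i + l := ⟨(n - i).toNat, by omega⟩
    have e1 : (fun k : ℕ => a (i + 1 + (k + l : ℕ))) = fun k : ℕ => a (n + 1 + k) := by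
      funext k; congr 1; omega
    have e2 : (fun k : ℕ => a' (i + 1 + (k + l : ℕ))) = fun k : ℕ => a' (n + 1 + k) := by
      funext k; congr 1; omega
    have e3 : (fun k : ℕ => splice a n w (i + 1 + (k + l : ℕ))) = w := by
      funext k
      rw [← splice_add a n w k]
      congr 1
      omega
    have hright := cfVal_mem_uIcc (ha.comp (fun k : ℕ => i + 1 + k))
      (ha'.comp (fun k : ℕ => i + 1 + k)) (hc.comp (fun k : ℕ => i + 1 + k)) l
      (fun j hj => (splice_of_le (by omega)).symm)
      (fun j hj => by
        rw [splice_of_le (by omega)]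
        exact (hagree _ (by omega) (by omega)).symm) (by
        rw [e1, e2, e3]; exact hbetween)
    have eleft : (fun k : ℕ => splice a n w (i - 1 - k)) = fun k : ℕ => a (i - 1 - k) := by
      funext k
      exact splice_of_le (by omega)
    have hleft := (abs_le.1 (cfVal_dist (ha.comp (fun k : ℕ => i - 1 - k))
      (ha'.comp (fun k : ℕ => i - 1 - k)) (n := N)
      (fun j hj => hagree _ (by omega) (by omega)))).2
    have h1 := hm i
    have h2 := hm' i
    rw [cfSum] at h1 h2 ⊢
    rw [← hagree i (by omega) hi] at h2
    rw [eleft, splice_of_le hi]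
    rw [Set.mem_uIcc] at hright
    rcases hright with h | h <;> linarith [h.2]

/-- The sequence `w 0, …, w (l - 1), 1, 1, …`. -/
def onesTail (l : List ℕ) : ℕ → ℕ := fun k => l.getD k 1

theorem onesTail_eq_one {l : List ℕ} {k : ℕ} (h : l.length ≤ k) : onesTail l k = 1 :=
  List.getD_eq_default _ _ h

theorem digits_onesTail {l : List ℕ} (h : ∀ x ∈ l, 1 ≤ x ∧ x ≤ 3) : Digits (onesTail l) :=
  fun k => by
    rcases lt_or_ge k l.length with hk | hk
    · rw [onesTail, List.getD_eq_getElem _ _ hk]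
      exact h _ (List.getElem_mem hk)
    · rw [onesTail_eq_one hk]; omega

theorem onesTail_le {l : List ℕ} {B : ℕ} (hB : 1 ≤ B) (h : ∀ x ∈ l, x ≤ B) (k : ℕ) :
    onesTail l k ≤ B := by
  rcases lt_or_ge k l.length with hk | hk
  · rw [onesTail, List.getD_eq_getElem _ _ hk]
    exact h _ (List.getElem_mem hk)
  · rw [onesTail_eq_one hk]; exact hB

theorem cfSum_splice_le {a : ℤ → ℕ} (ha : Digits a) (n : ℤ) {w : ℕ → ℕ} (hw : Digits w) {k : ℕ}
    (h : w k ≤ 2) : cfSum (splice a n w) (n + 1 + k) ≤ 3.84 :=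
  (cfSum_le_of_digit_le_two (ha.splice hw n) (by rw [splice_add]; exact h)).trans (by norm_num)

theorem cfSum_splice_two_three_two_le {a : ℤ → ℕ} (ha : Digits a) (n : ℤ) (k : ℕ) :
    cfSum (splice a n (onesTail [2, 3, 2])) (n + 1 + k) ≤ 3.84 := by
  have hw : Digits (onesTail [2, 3, 2]) := digits_onesTail (by simp)
  by_cases hk : k = 1
  · subst hk
    have hc := ha.splice hw n
    set c := splice a n (onesTail [2, 3, 2]) with hcdef
    have e0 : c (n + 1 + (1 : ℕ)) = 3 := splice_add a n _ 1
    have e1 : c (n + 1 + (1 : ℕ) - 1 - (0 : ℕ)) = 2 := by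
      have := splice_add a n (onesTail [2, 3, 2]) 0
      rw [← hcdef] at this
      refine Eq.trans ?_ this
      congr 1
      push_cast
      ring
    have e2 : c (n + 1 + (1 : ℕ) + 1 + (0 : ℕ)) = 2 := by
      have := splice_add a n (onesTail [2, 3, 2]) 2
      rw [← hcdef] at this
      refine Eq.trans ?_ this
      congr 1
      push_cast
      ring
    have e3 : c (n + 1 + (1 : ℕ) + 1 + (0 + 1 : ℕ)) = 1 := by
      have := splice_add a n (onesTail [2, 3, 2]) 3
      rw [← hcdef] at this
      refine Eq.trans ?_ this
      congr 1
      push_cast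
      ring
    rw [cfSum, e0, cfVal_eq (hc.comp (fun k : ℕ => n + 1 + (1 : ℕ) + 1 + k)),
      cfVal_eq (hc.comp (fun k : ℕ => n + 1 + (1 : ℕ) - 1 - k)), e1, e2,
      cfVal_eq (hc.comp (fun k : ℕ => n + 1 + (1 : ℕ) + 1 + (k + 1 : ℕ))), e3]
    have h1 := cfVal_mem (hc.comp (fun k : ℕ => n + 1 + (1 : ℕ) - 1 - (k + 1 : ℕ)))
    have h2 := cfVal_mem (hc.comp (fun k : ℕ => n + 1 + (1 : ℕ) + 1 + (k + 1 + 1 : ℕ)))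
    set x := cfVal (fun k : ℕ => c (n + 1 + (1 : ℕ) - 1 - (k + 1 : ℕ)))
    set y := cfVal (fun k : ℕ => c (n + 1 + (1 : ℕ) + 1 + (k + 1 + 1 : ℕ)))
    have h3 : 1 / ((2 : ℕ) + x) ≤ 4 / 9 := by
      rw [div_le_div_iff₀ (by push_cast; linarith) (by norm_num)]; push_cast; linarith
    have h4 : 5 / 9 ≤ 1 / ((1 : ℕ) + y) := by
      rw [div_le_div_iff₀ (by norm_num) (by push_cast; linarith)]; push_cast; linarith
    have h5 : 1 / ((2 : ℕ) + 1 / ((1 : ℕ) + y)) ≤ 9 / 23 := by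
      rw [div_le_div_iff₀ (by push_cast; linarith) (by norm_num)]; push_cast at h4 ⊢; linarith
    push_cast at h3 h5 ⊢
    linarith
  · refine cfSum_splice_le ha n hw ?_
    rcases k with _ | _ | _ | k
    · decide
    · exact absurd rfl hk
    · decide
    · rw [onesTail_eq_one (by simp)]; norm_num

theorem mem_uIcc_of_lt {x y z : ℝ} (h1 : y < z) (h2 : z < x) : z ∈ Set.uIcc x y :=
  Set.mem_uIcc.2 (Or.inr ⟨h1.le, h2.le⟩)

/-- Two sequences that cannot be connected to the constant sequence `1` branch sparsely. -/
theorem sparse_of_not_rightConnectable {a a' : ℤ → ℕ} {m m' ε : ℝ} {N : ℕ} {n : ℤ}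
    (ha : Digits a) (ha' : Digits a') (hm : ∀ i, cfSum a i ≤ m) (hm' : ∀ i, cfSum a' i ≤ m')
    (hmm : m' ≤ m + ε / 4) (hε : 2 * (16 / 25 : ℝ) ^ N ≤ ε / 4) (h384 : 3.84 ≤ m) (hn : N ≤ n)
    (hagree : ∀ i, -(N : ℤ) ≤ i → i ≤ n → a i = a' i) (hno : ¬RightConnectable a m ε N) :
    ¬(a (n + 1) = 1 ∧ a' (n + 1) = 3) ∧ (a (n + 1) = 2 → a' (n + 1) = 3 → a (n + 2) = 1) ∧
      (a (n + 1) = 1 → a' (n + 1) = 2 → a (n + 2) = 1 ∧ a' (n + 2) = 3) := by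
  have hγ := ha.comp (fun k : ℕ => n + 1 + k)
  have hδ := ha'.comp (fun k : ℕ => n + 1 + k)
  have f0 : n + 1 + ((0 : ℕ) : ℤ) = n + 1 := by simp
  have f1 : n + 1 + ((1 : ℕ) : ℤ) = n + 2 := by push_cast; ring
  have hD : ∀ l ∈ ({[], [2], [2, 3, 2]} : Set (List ℕ)), Digits (onesTail l) := by
    rintro l (rfl | rfl | rfl) <;> exact digits_onesTail (by simp)
  have key : ∀ l ∈ ({[], [2], [2, 3, 2]} : Set (List ℕ)),
      cfVal (fun k : ℕ => a' (n + 1 + k)) < cfVal (onesTail l) →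
      cfVal (onesTail l) < cfVal (fun k : ℕ => a (n + 1 + k)) → False := by
    intro l hl h1 h2
    refine hno (rightConnectable_of_between ha ha' hm hm' hmm hε h384 hn hagree (hD l hl)
      (R := l.length) (fun k hk => onesTail_eq_one hk) (mem_uIcc_of_lt h1 h2) fun k => ?_)
    rcases hl with rfl | rfl | rfl
    · exact cfSum_splice_le ha n (hD _ (by simp)) (onesTail_le (by norm_num) (by simp) k)
    · exact cfSum_splice_le ha n (hD _ (by simp)) (onesTail_le (by norm_num) (by simp) k)
    · exact cfSum_splice_two_three_two_le ha n k
  refine ⟨fun ⟨h1, h3⟩ => ?_, fun h2 h3 => ?_, fun h1 h2 => ⟨?_, ?_⟩⟩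
  · refine key [2] (by simp) (cfVal_lt_of_digit_lt (hD _ (by simp)) hδ ?_)
      (cfVal_lt_of_digit_lt hγ (hD _ (by simp)) ?_)
    · rw [f0, h3]; decide
    · rw [f0, h1]; decide
  · by_contra hne
    have := (ha (n + 2)).1
    refine key [2] (by simp) (cfVal_lt_of_digit_lt (hD _ (by simp)) hδ ?_)
      (cfVal_lt_of_second_digit_lt hγ (hD _ (by simp)) ?_ ?_)
    · rw [f0, h3]; decide
    · rw [f0, h2]; rfl
    · rw [f1]
      change 1 < _
      omega
  · by_contra hne
    have := (ha (n + 2)).1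
    refine key [] (by simp) (cfVal_lt_of_digit_lt (hD _ (by simp)) hδ ?_)
      (cfVal_lt_of_second_digit_lt hγ (hD _ (by simp)) ?_ ?_)
    · rw [f0, h2]; decide
    · rw [f0, h1]; rfl
    · rw [f1]
      change 1 < _
      omega
  · by_contra hne
    have := (ha' (n + 2)).2
    refine key [2, 3, 2] (by simp) (cfVal_lt_of_second_digit_lt (hD _ (by simp)) hδ ?_ ?_)
      (cfVal_lt_of_digit_lt hγ (hD _ (by simp)) ?_)
    · rw [f0, h2]; rfl
    · rw [f1]
      change _ < 3
      omega
    · rw [f0, h1]; decide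

/-- The sequences of values bounded by the value at the origin that cannot be connected to the
constant sequence `1`, classified by the data `k`, `N` on the failure, the approximate value `J`
and the central digits `σ`. -/
def disconnectedSeqs (k N : ℕ) (J : ℤ) (σ : List ℕ) : Set (ℤ → ℕ) :=
  {a | Digits a ∧ 3.84 ≤ cfSum a 0 ∧ (∀ i, cfSum a i ≤ cfSum a 0) ∧ 2 ≤ N ∧
    2 * (16 / 25 : ℝ) ^ N ≤ 1 / ((k : ℝ) + 1) / 4 ∧
    ¬RightConnectable a (cfSum a 0) (1 / ((k : ℝ) + 1)) N ∧
    ⌊cfSum a 0 / (1 / ((k : ℝ) + 1) / 4)⌋ = J ∧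
    (List.range (2 * N + 1)).map (fun j : ℕ => a (j - N)) = σ}

theorem dimH_disconnectedSeqs_le (k N : ℕ) (J : ℤ) (σ : List ℕ) :
    dimH (cfVal '' ((fun a (j : ℕ) => a (0 + 1 + j)) '' disconnectedSeqs k N J σ)) ≤
      ((9 / 32 : NNReal) : ENNReal) := by
  rcases (disconnectedSeqs k N J σ).eq_empty_or_nonempty with h | ⟨a₀, -, -, -, hN, hε, -⟩
  · simp [h]
  have hcentral : ∀ a ∈ disconnectedSeqs k N J σ, ∀ a' ∈ disconnectedSeqs k N J σ,
      ∀ i : ℤ, -N ≤ i → i ≤ N → a i = a' i := by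
    rintro a ⟨-, -, -, -, -, -, -, h⟩ a' ⟨-, -, -, -, -, -, -, h'⟩ i hi hi'
    rw [← h', List.map_inj_left] at h
    have := h (i + N).toNat (List.mem_range.2 (by omega))
    rwa [show (((i + N).toNat : ℕ) : ℤ) - N = i by omega] at this
  refine dimH_cfVal_image_le (N := N) ?_ hN ?_ ?_
  · rintro _ ⟨a, ha, rfl⟩
    exact ha.1.comp _
  · rintro _ ⟨a, ha, rfl⟩ _ ⟨a', ha', rfl⟩ i hi
    exact hcentral a ha a' ha' _ (by omega) (by omega)
  · rintro _ ⟨a, ha, rfl⟩ _ ⟨a', ha', rfl⟩ n hn hagree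
    have h0 := hcentral a ha a' ha'
    obtain ⟨hD, h384, hle, -, -, hno, hJ, -⟩ := ha
    obtain ⟨hD', -, hle', -, -, -, hJ', -⟩ := ha'
    have hk : (0 : ℝ) < 1 / ((k : ℝ) + 1) / 4 := by positivity
    have hmm : cfSum a' 0 ≤ cfSum a 0 + 1 / ((k : ℝ) + 1) / 4 := by
      have h1 := Int.floor_le (cfSum a 0 / (1 / ((k : ℝ) + 1) / 4))
      have h2 := Int.lt_floor_add_one (cfSum a' 0 / (1 / ((k : ℝ) + 1) / 4))
      rw [hJ] at h1
      rw [hJ'] at h2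
      rw [le_div_iff₀ hk] at h1
      rw [div_lt_iff₀ hk] at h2
      linarith
    have := sparse_of_not_rightConnectable (n := n) hD hD' hle hle' hmm hε h384
      (by exact_mod_cast hn) (fun i hi hi' => by
        rcases le_or_gt i N with h | h
        · exact h0 i hi h
        · have := hagree (i - 1).toNat (by omega)
          simp only at this
          rwa [show (0 : ℤ) + 1 + ((i - 1).toNat : ℤ) = i by omega] at this) hno
    have f1 : (0 : ℤ) + 1 + (n : ℕ) = n + 1 := by ring
    have f2 : (0 : ℤ) + 1 + ((n + 1 : ℕ) : ℤ) = n + 2 := by push_cast; ring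
    simp only [f1, f2]
    exact this

/-- The countable union of translates of sparsely branching sets of continued fractions. -/
def sparseSet : Set ℝ :=
  ⋃ p : ℕ × ℕ × ℤ × List ℕ × ℕ, (fun x => (p.2.2.2.2 : ℝ) + x) ''
    (cfVal '' ((fun a (j : ℕ) => a (0 + 1 + j)) '' disconnectedSeqs p.1 p.2.1 p.2.2.1 p.2.2.2.1))

theorem dimH_sparseSet_lt : dimH sparseSet < ENNReal.ofReal 0.281266 := by
  have h1 : dimH sparseSet ≤ ((9 / 32 : NNReal) : ENNReal) := by
    rw [sparseSet, dimH_iUnion]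
    refine iSup_le fun p => ?_
    rw [(isometry_add_left (p.2.2.2.2 : ℝ)).dimH_image]
    exact dimH_disconnectedSeqs_le _ _ _ _
  refine h1.trans_lt ?_
  rw [ENNReal.lt_ofReal_iff_toReal_lt ENNReal.coe_ne_top]
  simp
  norm_num

open scoped Pointwise in
theorem cfSum_mem_add_sparseSet {a : ℤ → ℕ} (ha : Digits a) (h384 : 3.84 ≤ cfSum a 0)
    (hle : ∀ i, cfSum a i ≤ cfSum a 0) {ε : ℝ} (hε : 0 < ε) {N : ℕ}
    (hno : ¬RightConnectable a (cfSum a 0) ε N) :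
    cfSum a 0 ∈ contFracSet {1, 2, 3} + sparseSet := by
  obtain ⟨k, hk⟩ := exists_nat_one_div_lt hε
  obtain ⟨N₁, hN₁⟩ := exists_pow_le (show (0 : ℝ) < 1 / ((k : ℝ) + 1) / 4 by positivity) 2
  set N' := max (max N 2) N₁ with hN'
  have hmem : a ∈ disconnectedSeqs k N' ⌊cfSum a 0 / (1 / ((k : ℝ) + 1) / 4)⌋
      ((List.range (2 * N' + 1)).map (fun j : ℕ => a (j - N'))) :=
    ⟨ha, h384, hle, by omega, hN₁ N' (by omega), fun h => hno (h.mono hk.le (by omega)), rfl, rfl⟩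
  refine ⟨_, cfVal_mem_contFracSet (ha.comp (fun k : ℕ => 0 - 1 - k)),
    a 0 + cfVal (fun k : ℕ => a (0 + 1 + k)), ?_, ?_⟩
  · exact Set.mem_iUnion.2 ⟨(k, N', _, _, a 0), _, ⟨_, ⟨a, hmem, rfl⟩, rfl⟩, rfl⟩
  · simp only [cfSum]
    ring

open scoped Pointwise in
theorem mainTheorem11 :
    ∃ K : Set ℝ, dimH K < ENNReal.ofReal 0.281266 ∧
      (markovSpectrum \ lagrangeSpectrum) ∩ Set.Ioo (3.84 : ℝ) (√20) ⊆
        contFracSet {1, 2, 3} + K := by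
  refine ⟨sparseSet, dimH_sparseSet_lt, ?_⟩
  rintro m ⟨⟨hM, hL⟩, h1, h2⟩
  obtain ⟨a, ha, rfl, hle⟩ := exists_digits_of_mem_markovSpectrum hM (by linarith) h2
  by_contra hm
  have hrev : cfSum (fun i => a (-i)) 0 = cfSum a 0 := by rw [cfSum_comp_neg, neg_zero]
  refine hL (mem_lagrangeSpectrum_of_two_sided fun ε hε => exists_two_sided ha rfl ?_ ?_ hε)
  · intro ε hε N
    by_contra hno
    exact hm (cfSum_mem_add_sparseSet ha h1.le hle hε hno)
  · intro ε hε N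
    by_contra hno
    rw [← hrev] at h1 hm hno
    exact hm (cfSum_mem_add_sparseSet (ha.comp _) h1.le
      (fun i => by rw [cfSum_comp_neg, hrev]; exact hle _) hε hno)
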